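/- Let $k$ be a field, let $n\ge 1$ and $a\ge 0$ be integers, and let $A=k[x_{i,j}: 1\le i\le n,\ 0\le j\le a]$, with $\deg x_{i,j}=\mathbf e_i\in\mathbb Z^n$, be the Cox ring of the $n$-fold product $(\mathbb P^a)^n$ over $k$. Integral closed subschemes of $(\mathbb P^a)^n$ correspond to the multigraded primes of $A$ that contain none of the ideals $(x_{i,0},\dots,x_{i,a})$. Let $\mathrm{Chow}((\mathbb P^a)^n)$ be the group of algebraic cycles on $(\mathbb P^a)^n$ modulo rational equivalence. For each $i$ let $\zeta_i$ be the class of a hyperplane of the $i$-th factor, i.e. the first Chern class of the pullback of $\mathcal O(1)$ along the $i$-th projection: multiplication by $\zeta_i$ sends the class of a subvariety $V$ to the class of the divisor on $V$ of any coordinate $x_{i,j}$ that does not vanish identically on $V$, and the fundamental class of $(\mathbb P^a)^n$ is the unit of the Chow ring. Let $\Delta\subseteq(\mathbb P^a)^n$ be the small diagonal, i.e. the image of $\mathbb P^a$ under $p\mapsto(p,\dots,p)$, with its reduced structure. Then the class of $\Delta$ in $\mathrm{Chow}((\mathbb P^a)^n)$ is $$ c(\Delta)=\sum_{\alpha}\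 \prod_{i=1}^n\zeta_i^{\alpha_i}, $$ where the sum runs over all $\alpha\in\mathbb Z^n$ with $0\le\alpha_i\le a$ for all $i$ and $\sum_{i=1}^n\alpha_i=a(n-1)$; that is, each of these monomials occurs with coefficient $1$. -/

import Mathlib

/-!
Cycles, rational equivalence and Chow groups of the `n`-fold product `(ℙᵃ)ⁿ` of projective
`a`-space over a field `k`, in terms of its Cox ring
`A = k[x_{i,j} : i ∈ Fin n, j ∈ Fin (a + 1)]`, graded by `ℤⁿ` with `deg x_{i,j} = eᵢ`.

Closed subschemes of `(ℙᵃ)ⁿ` are given by multigraded ideals of `A`, and an ideal matters only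
up to components that contain one of the irrelevant ideals `(x_{i,0}, …, x_{i,a})`.
-/

namespace MultiProj

/-- The Cox ring of `(ℙᵃ)ⁿ`; the variable `(i, j)` is the `j`-th homogeneous coordinate of the
`i`-th factor. -/
abbrev CoxRing (k : Type*) [Field k] (n a : ℕ) : Type _ :=
  MvPolynomial (Fin n × Fin (a + 1)) k

/-- The multidegree `eᵢ` of the variable `x_{i,j}`. -/
def multidegree (n a : ℕ) : Fin n × Fin (a + 1) → (Fin n → ℕ) :=
  fun p => Pi.single p.1 1

/-- `f` is a form of multidegree `d` (the zero polynomial is a form of every multidegree). -/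
def IsForm {k : Type*} [Field k] {n a : ℕ} (f : CoxRing k n a) (d : Fin n → ℕ) : Prop :=
  MvPolynomial.IsWeightedHomogeneous (multidegree n a) f d

/-- The ideal `I` is multigraded: it contains all the multihomogeneous components of each of its
elements. -/
def IsMultigraded {k : Type*} [Field k] {n a : ℕ} (I : Ideal (CoxRing k n a)) : Prop :=
  ∀ f ∈ I, ∀ d : Fin n → ℕ,
    MvPolynomial.weightedHomogeneousComponent (multidegree n a) d f ∈ I

/-- An integral closed subscheme of `(ℙᵃ)ⁿ`, that is, a multigraded prime ideal of the Cox ring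
that contains none of the irrelevant ideals `(x_{i,0}, …, x_{i,a})`. -/
@[ext]
structure Subvariety (k : Type*) [Field k] (n a : ℕ) where
  ideal : Ideal (CoxRing k n a)
  isPrime : ideal.IsPrime
  isMultigraded : IsMultigraded ideal
  relevant : ∀ i : Fin n, ∃ j : Fin (a + 1),
    (MvPolynomial.X (i, j) : CoxRing k n a) ∉ ideal

attribute [instance] Subvariety.isPrime

/-- Algebraic cycles on `(ℙᵃ)ⁿ` (of all dimensions): the free abelian group on the integral closed
subschemes. -/
abbrev Cycles (k : Type*) [Field k] (n a : ℕ) : Type _ :=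
  Subvariety k n a →₀ ℤ

/-- The length of the local ring of the subscheme cut out by `I` along the subvariety `V`.
The local ring at `V` is computed on `Spec A`; since `V` is relevant, the localization `A_Q` at the
ideal `Q` of `V` is flat over the local ring of `(ℙᵃ)ⁿ` at the generic point of `V`, with the maximal
ideal generating the maximal ideal, so that this length agrees with the length on `(ℙᵃ)ⁿ`. -/
noncomputable def lengthAlong {k : Type*} [Field k] {n a : ℕ}
    (I : Ideal (CoxRing k n a)) (V : Subvariety k n a) : ℕ∞ :=
  Module.length (Localization.AtPrime V.ideal)
    (Localization.AtPrime V.ideal ⧸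
      I.map (algebraMap (CoxRing k n a) (Localization.AtPrime V.ideal)))

theorem finite_components {k : Type*} [Field k] {n a : ℕ} (I : Ideal (CoxRing k n a)) :
    {V : Subvariety k n a | V.ideal ∈ I.minimalPrimes}.Finite :=
  (I.finite_minimalPrimes_of_isNoetherianRing (CoxRing k n a)).preimage
    (fun _ _ _ _ h => Subvariety.ext h)

/-- The fundamental cycle `[Z] = ∑_V length(𝒪_{Z,V}) [V]` of the subscheme `Z` of `(ℙᵃ)ⁿ` cut out by
a multigraded ideal `I`; here `V` runs over the irreducible components of `Z`. (Along a component
the length is finite.) -/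
noncomputable def fundamentalCycle {k : Type*} [Field k] {n a : ℕ}
    (I : Ideal (CoxRing k n a)) : Cycles k n a :=
  Finsupp.ofSupportFinite
    (Set.indicator {V : Subvariety k n a | V.ideal ∈ I.minimalPrimes}
      (fun V => ((lengthAlong I V).toNat : ℤ)))
    ((finite_components I).subset Set.support_indicator_subset)

/-- The divisor on the subvariety `V` of a form `g` that does not vanish identically on `V`, as a
cycle on `(ℙᵃ)ⁿ`: the sum over the subvarieties `W` of `V` of codimension one of
`length(𝒪_{V,W} / g) [W]`, that is, the fundamental cycle of the subscheme `V ∩ {g = 0}`. -/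
noncomputable def divisor {k : Type*} [Field k] {n a : ℕ}
    (V : Subvariety k n a) (g : CoxRing k n a) : Cycles k n a :=
  fundamentalCycle (V.ideal ⊔ Ideal.span {g})

/-- The group of cycles rationally equivalent to zero, generated by the divisors
`div(g / h) = div(g) - div(h)` of the nonzero rational functions `g / h` on the subvarieties `V`;
here `g` and `h` are forms of the same multidegree that do not vanish identically on `V`. -/
noncomputable def ratEquivZero (k : Type*) [Field k] (n a : ℕ) : AddSubgroup (Cycles k n a) :=
  AddSubgroup.closure
    {z | ∃ (V : Subvariety k n a) (d : Fin n → ℕ) (g h : CoxRing k n a),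
      IsForm g d ∧ IsForm h d ∧ g ∉ V.ideal ∧ h ∉ V.ideal ∧ z = divisor V g - divisor V h}

/-- The Chow group of `(ℙᵃ)ⁿ`: cycles (of all dimensions) modulo rational equivalence. -/
abbrev Chow (k : Type*) [Field k] (n a : ℕ) : Type _ :=
  Cycles k n a ⧸ ratEquivZero k n a

/-- The class of a cycle in the Chow group. -/
noncomputable def chowClass {k : Type*} [Field k] {n a : ℕ} : Cycles k n a →+ Chow k n a :=
  QuotientAddGroup.mk' (ratEquivZero k n a)

/-- The first of the coordinates `x_{i,0}, …, x_{i,a}` of the `i`-th factor that does not vanish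
identically on `V`. -/
noncomputable def Subvariety.coord {k : Type*} [Field k] {n a : ℕ}
    (V : Subvariety k n a) (i : Fin n) : Fin (a + 1) :=
  wellFounded_lt.min
    {j : Fin (a + 1) | (MvPolynomial.X (i, j) : CoxRing k n a) ∉ V.ideal} (V.relevant i)

/-- Multiplication by the class `ζᵢ` of a hyperplane of the `i`-th factor, that is, by the first
Chern class of the pullback `L` of `𝒪(1)` from the `i`-th factor: a subvariety `V` goes to the
divisor on `V` of a section of `L` that does not vanish identically on `V`. Another choice of
the section changes the result by the divisor of a rational function on `V`. -/
noncomputable def zeta (k : Type*) [Field k] (n a : ℕ) (i : Fin n) :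
    AddMonoid.End (Cycles k n a) :=
  Finsupp.liftAddHom fun V : Subvariety k n a =>
    (zmultiplesHom (Cycles k n a)) (divisor V (MvPolynomial.X (i, V.coord i)))

/-- A cycle that represents the monomial `∏ᵢ ζᵢ ^ αᵢ` of the Chow ring: the fundamental cycle of
`(ℙᵃ)ⁿ`, which is the unit of the Chow ring, multiplied `αᵢ` times by `ζᵢ` for each `i`. -/
noncomputable def zetaMonomial (k : Type*) [Field k] (n a : ℕ) (α : Fin n → ℕ) : Cycles k n a :=
  (List.ofFn fun i => zeta k n a i ^ α i).prod (fundamentalCycle ⊥)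

/-- The multigraded ideal of the small diagonal `Δ ⊆ (ℙᵃ)ⁿ`, the image of the diagonal embedding
`p ↦ (p, …, p)` of `ℙᵃ`. In homogeneous coordinates a point of `Δ` is `(t₁ y, …, tₙ y)`, so the
ideal is the kernel of `x_{i,j} ↦ tᵢ yⱼ`; a form `f` lies in it exactly if `f(y, …, y) = 0`. -/
noncomputable def diagonalIdeal (k : Type*) [Field k] (n a : ℕ) : Ideal (CoxRing k n a) :=
  RingHom.ker (MvPolynomial.aeval (R := k) fun p : Fin n × Fin (a + 1) =>
    (MvPolynomial.X (Sum.inl p.1) * MvPolynomial.X (Sum.inr p.2) :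
      MvPolynomial (Fin n ⊕ Fin (a + 1)) k))

end MultiProj

/-! The diagonal is degenerated, one factor at a time, into products of coordinate subspaces. The
intermediate varieties are those of a `Config`: the points of a group coincide, some coordinates
vanish, and the coordinates in a set `M` of columns of one further point `x_r` are proportional to
those of the group.

Let `j ∈ M`, `m ∉ M`, and let `i` be in the group. On such a variety the forms `x_{r,j} x_{i,m} -
x_{r,m} x_{i,j}` and `x_{r,j} x_{i,m}` have the same multidegree, so their divisors are rationally
equivalent. The first divisor is the variety with `m` added to `M`, plus the locus where column `j`
vanishes on `x_r` and on the group. The second is the locus where `x_r` vanishes on `M`, plus the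
locus where the group vanishes at `m`, plus the same column locus. All multiplicities are one and
the column locus cancels; if `M = {j}`, it has codimension two and is absent from both sides. The
result is `Addable.cls_addCol`.

Iterating over the columns separates `x_r` from the group (`cls_cols`), and induction on the group
expresses a diagonal through products of coordinate subspaces (`cls_diag`). Such a product has the
class of a monomial, since coordinate hyperplanes of one factor can be exchanged (`cls_linear`).
Each admissible exponent vector arises exactly once (`sum_diagSum`).

To compute the divisors, the ideal of a configuration is defined as the kernel of a parametrization,
hence is prime and multigraded. It is compared with the explicit equations only at ring-valued
points: points in local rings at the expected components decide the multiplicities, and points in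
residue fields show that nothing else occurs (`divisor_subvariety`). -/

namespace MultiProj

/-! ### Fundamental cycles of generically reduced subschemes -/

section FundamentalCycle

variable {k : Type*} [Field k] {n a : ℕ}

/-- The extension of `J` to the local ring is the maximal ideal, so the quotient is the residue
field, a simple module. -/
theorem lengthAlong_eq_one {J : Ideal (CoxRing k n a)} {V : Subvariety k n a}
    (hJ : J ≤ V.ideal)
    (hloc : ∀ f ∈ V.ideal, algebraMap (CoxRing k n a) (Localization.AtPrime V.ideal) f ∈
      J.map (algebraMap (CoxRing k n a) (Localization.AtPrime V.ideal))) :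
    lengthAlong J V = 1 := by
  have h : J.map (algebraMap (CoxRing k n a) (Localization.AtPrime V.ideal)) =
      IsLocalRing.maximalIdeal (Localization.AtPrime V.ideal) := by
    rw [← Localization.AtPrime.map_eq_maximalIdeal]
    exact le_antisymm (Ideal.map_mono hJ) (Ideal.map_le_iff_le_comap.2 hloc)
  rw [lengthAlong, h, Module.length_eq_one_iff, isSimpleModule_iff_isCoatom]
  exact (IsLocalRing.maximalIdeal.isMaximal _).out

/-- If `J` is contained in the ideals of the subvarieties in `s`, agrees with each of them locally
at that subvariety, and has no further components, then its fundamental cycle is reduced. -/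
theorem fundamentalCycle_eq_sum (J : Ideal (CoxRing k n a)) (s : Finset (Subvariety k n a))
    (hle : ∀ V ∈ s, J ≤ V.ideal)
    (hloc : ∀ V ∈ s, ∀ f ∈ V.ideal,
      algebraMap (CoxRing k n a) (Localization.AtPrime V.ideal) f ∈
        J.map (algebraMap (CoxRing k n a) (Localization.AtPrime V.ideal)))
    (hcov : ∀ W : Subvariety k n a, J ≤ W.ideal → ∃ V ∈ s, V.ideal ≤ W.ideal) :
    fundamentalCycle J = ∑ V ∈ s, Finsupp.single V 1 := by
  classical
  have hmin : ∀ V ∈ s, V.ideal ∈ J.minimalPrimes := by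
    intro V hV
    refine ⟨⟨V.isPrime, hle V hV⟩, fun p hp hpV f hf => ?_⟩
    have hp' := hp.1
    -- Local equality gives `t ∉ V.ideal` with `t * f ∈ J`. A prime between `J` and `V.ideal` cannot
    -- contain `t`, so it contains `f`.
    obtain ⟨t, ht, htf⟩ := (IsLocalization.algebraMap_mem_map_algebraMap_iff
      V.ideal.primeCompl _ _ _).1 (hloc V hV f hf)
    exact (hp'.mem_or_mem (hp.2 htf)).resolve_left fun h => ht (hpV h)
  have hmem : ∀ W : Subvariety k n a, W.ideal ∈ J.minimalPrimes ↔ W ∈ s := by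
    refine fun W => ⟨fun hW => ?_, hmin W⟩
    obtain ⟨V, hV, hVW⟩ := hcov W hW.1.2
    have : W = V := Subvariety.ext (le_antisymm (hW.2 ⟨V.isPrime, hle V hV⟩ hVW) hVW)
    exact this ▸ hV
  ext W
  simp only [fundamentalCycle, Finsupp.ofSupportFinite_coe, Finsupp.finsetSum_apply,
    Finsupp.single_apply, Finset.sum_ite_eq', Set.indicator_apply, Set.mem_ofPred_eq, hmem]
  split_ifs with hW
  · rw [lengthAlong_eq_one (hle W hW) (hloc W hW)]; rfl
  · rfl

theorem fundamentalCycle_ideal (V : Subvariety k n a) :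
    fundamentalCycle V.ideal = Finsupp.single V 1 := by
  classical
  rw [fundamentalCycle_eq_sum V.ideal {V}]
  · simp
  · simp
  · intro W hW f hf
    rw [Finset.mem_singleton] at hW
    subst hW
    exact Ideal.mem_map_of_mem _ hf
  · exact fun W hW => ⟨V, by simp, hW⟩

theorem chowClass_divisor_eq (V : Subvariety k n a) (d : Fin n → ℕ) {g h : CoxRing k n a}
    (hg : IsForm g d) (hh : IsForm h d) (hgV : g ∉ V.ideal) (hhV : h ∉ V.ideal) :
    chowClass (divisor V g) = chowClass (divisor V h) := by
  rw [← sub_eq_zero, ← map_sub]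
  exact (QuotientAddGroup.eq_zero_iff _).2
    (AddSubgroup.subset_closure ⟨V, d, g, h, hg, hh, hgV, hhV, rfl⟩)

theorem isForm_X (i : Fin n) (j : Fin (a + 1)) :
    IsForm (MvPolynomial.X (i, j) : CoxRing k n a) (Pi.single i 1) :=
  MvPolynomial.isWeightedHomogeneous_X _ _ _

end FundamentalCycle

/-! ### Kernels of multigraded homomorphisms -/

section Multigraded

variable {k : Type*} [Field k] {n a : ℕ} {τ : Type*}

/-- The substitution preserves the degrees of the variables, so it sends monomials to forms of the
same degree; the kernel is then multigraded. -/
theorem weightedHomogeneousComponent_aeval (w : τ → (Fin n → ℕ))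
    (e : Fin n × Fin (a + 1) → MvPolynomial τ k)
    (he : ∀ p, MvPolynomial.IsWeightedHomogeneous w (e p) (multidegree n a p))
    (f : CoxRing k n a) (d : Fin n → ℕ) :
    MvPolynomial.weightedHomogeneousComponent w d (MvPolynomial.aeval e f) =
      MvPolynomial.aeval e
        (MvPolynomial.weightedHomogeneousComponent (multidegree n a) d f) := by
  classical
  induction f using MvPolynomial.induction_on' with
  | monomial m c =>
    have h1 : MvPolynomial.IsWeightedHomogeneous w
        (MvPolynomial.aeval e (MvPolynomial.monomial m c))
        (Finsupp.weight (multidegree n a) m) := by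
      rw [MvPolynomial.aeval_monomial, MvPolynomial.algebraMap_eq]
      refine MvPolynomial.IsWeightedHomogeneous.C_mul ?_ c
      rw [Finsupp.weight_apply]
      exact MvPolynomial.IsWeightedHomogeneous.prod _ _ _ fun p _ => (he p).pow _
    have h2 : MvPolynomial.IsWeightedHomogeneous (multidegree n a)
        (MvPolynomial.monomial m c) (Finsupp.weight (multidegree n a) m) :=
      MvPolynomial.isWeightedHomogeneous_monomial _ _ _ rfl
    by_cases hd : d = Finsupp.weight (multidegree n a) m
    · subst hd
      rw [h1.weightedHomogeneousComponent_same, h2.weightedHomogeneousComponent_same]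
    · rw [h1.weightedHomogeneousComponent_ne _ hd,
        h2.weightedHomogeneousComponent_ne _ hd, map_zero]
  | add p q hp hq => simp only [map_add, hp, hq]

theorem isMultigraded_ker_aeval (w : τ → (Fin n → ℕ))
    (e : Fin n × Fin (a + 1) → MvPolynomial τ k)
    (he : ∀ p, MvPolynomial.IsWeightedHomogeneous w (e p) (multidegree n a p)) :
    IsMultigraded (RingHom.ker (MvPolynomial.aeval (R := k) e)) := by
  intro f hf d
  rw [RingHom.mem_ker] at hf ⊢
  rw [← weightedHomogeneousComponent_aeval w e he, hf, map_zero]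

end Multigraded

/-! ### Partial diagonals -/

/-- A point `(x₁, …, xₙ)` of `(ℙᵃ)ⁿ` obeys the configuration if `x_{i,j} = 0` for `j ∈ zero i`, the
points `xᵢ` with `i ∈ group` coincide, and the coordinates with index in `cols` of the point
`x_row` are proportional to those of these points. -/
structure Config (n a : ℕ) where
  zero : Fin n → Finset (Fin (a + 1))
  group : Finset (Fin n)
  row : Fin n
  cols : Finset (Fin (a + 1))

namespace Config

variable {n a : ℕ}

structure Valid (c : Config n a) : Prop where
  zero_eq : ∀ i ∈ c.group, ∀ i' ∈ c.group, c.zero i = c.zero i'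
  row_notMem : c.row ∉ c.group ∨ c.cols = ∅
  notMem_zero_row : ∀ j ∈ c.cols, j ∉ c.zero c.row
  notMem_zero : ∀ j ∈ c.cols, ∀ i ∈ c.group, j ∉ c.zero i
  exists_notMem : ∀ i, ∃ j, j ∉ c.zero i

/-- The coordinates of a point that obeys the configuration, in terms of free parameters. -/
def entry {B : Type*} [CommRing B] (c : Config n a) (t : Fin n → B) (s : B) (v : Fin (a + 1) → B)
    (w : Fin n × Fin (a + 1) → B) (p : Fin n × Fin (a + 1)) : B :=
  if p.2 ∈ c.zero p.1 then 0
  else if p.1 ∈ c.group then t p.1 * (if p.2 ∈ c.cols then s * v p.2 else v p.2)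
  else if p.1 = c.row ∧ p.2 ∈ c.cols then t p.1 * v p.2 else w p

theorem map_entry {B B' : Type*} [CommRing B] [CommRing B'] (f : B →+* B') (c : Config n a)
    (t : Fin n → B) (s : B) (v : Fin (a + 1) → B) (w : Fin n × Fin (a + 1) → B)
    (p : Fin n × Fin (a + 1)) :
    f (c.entry t s v w p) = c.entry (f ∘ t) (f s) (f ∘ v) (f ∘ w) p := by
  unfold entry
  split_ifs <;> simp

/-- The equations of a configuration, for a family `x` of coordinates. -/
structure Sat {B : Type*} [CommRing B] (c : Config n a) (x : Fin n × Fin (a + 1) → B) :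
    Prop where
  zero : ∀ i, ∀ j ∈ c.zero i, x (i, j) = 0
  group : ∀ i ∈ c.group, ∀ i' ∈ c.group, ∀ j j', x (i, j) * x (i', j') = x (i, j') * x (i', j)
  row : ∀ i ∈ c.group, ∀ j ∈ c.cols, ∀ j' ∈ c.cols,
    x (c.row, j) * x (i, j') = x (c.row, j') * x (i, j)

theorem Valid.sat_entry {B : Type*} [CommRing B] {c : Config n a} (hc : c.Valid) (t : Fin n → B)
    (s : B) (v : Fin (a + 1) → B) (w : Fin n × Fin (a + 1) → B) : c.Sat (c.entry t s v w) where
  zero i j hj := by simp [entry, hj]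
  group i hi i' hi' j j' := by
    have h := hc.zero_eq i hi i' hi'
    simp only [entry, hi, hi', h, if_true]
    split_ifs <;> ring
  row i hi j hj j' hj' := by
    have hr : c.row ∉ c.group := hc.row_notMem.resolve_right (Finset.ne_empty_of_mem hj)
    simp only [entry, hi, hr, hj, hj', hc.notMem_zero j hj i hi, hc.notMem_zero j' hj' i hi,
      hc.notMem_zero_row j hj, hc.notMem_zero_row j' hj', if_true, if_false, and_self]
    ring

/-- Coordinates that satisfy the equations come from parameters, if enough of them are units. -/
theorem Sat.exists_entry {B : Type*} [CommRing B] {c : Config n a}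
    {x : Fin n × Fin (a + 1) → B} (hx : c.Sat x)
    (hu : c.group.Nonempty → ∃ i ∈ c.group, (∃ j, IsUnit (x (i, j))) ∧
      ((∀ j ∈ c.cols, x (i, j) = 0) ∨ ∃ j ∈ c.cols, IsUnit (x (i, j)))) :
    ∃ t s v, ∀ p, x p = c.entry t s v x p := by
  rcases c.group.eq_empty_or_nonempty with hG | hG
  · refine ⟨fun _ => 1, 1, fun j => x (c.row, j), ?_⟩
    rintro ⟨i, j⟩
    by_cases h0 : j ∈ c.zero i
    · simp [entry, h0, hx.zero i j h0]
    · by_cases h1 : i = c.row ∧ j ∈ c.cols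
      · obtain ⟨rfl, hj⟩ := h1
        simp [entry, h0, hG, hj]
      · simp [entry, h0, hG, h1]
  obtain ⟨i₀, hi₀, ⟨j₀, u, hu₀⟩, h⟩ := hu hG
  have key : ∀ i ∈ c.group, ∀ j, x (i, j) = x (i, j₀) * ↑u⁻¹ * x (i₀, j) := by
    intro i hi j
    have := hx.group i hi i₀ hi₀ j j₀
    rw [← hu₀] at this
    calc x (i, j) = x (i, j) * u * ↑u⁻¹ := by rw [Units.mul_inv_cancel_right]
      _ = _ := by rw [this]; ring
  -- If the columns vanish on the group, the row is unconstrained there: the common factor is `0`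
  -- and `v` records the row. Otherwise the common factor is `1`, and a unit in the columns gives
  -- the ratio of the row to the group.
  rcases h with h | ⟨j₁, hj₁, u₁, hu₁⟩
  · refine ⟨fun i => if i ∈ c.group then x (i, j₀) * ↑u⁻¹ else 1, 0,
      fun j => if j ∈ c.cols then x (c.row, j) else x (i₀, j), ?_⟩
    rintro ⟨i, j⟩
    by_cases h0 : j ∈ c.zero i
    · simp [entry, h0, hx.zero i j h0]
    by_cases hi : i ∈ c.group
    · by_cases hj : j ∈ c.cols
      · simp only [entry, h0, hi, hj, if_true, if_false]
        rw [key i hi j, h j hj]; ring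
      · simp only [entry, h0, hi, hj, if_true, if_false]
        exact key i hi j
    · by_cases h1 : i = c.row ∧ j ∈ c.cols
      · obtain ⟨rfl, hj⟩ := h1
        simp [entry, h0, hi, hj]
      · simp [entry, h0, hi, h1]
  · refine ⟨fun i => if i ∈ c.group then x (i, j₀) * ↑u⁻¹ else x (i, j₁) * ↑u₁⁻¹, 1,
      fun j => x (i₀, j), ?_⟩
    rintro ⟨i, j⟩
    by_cases h0 : j ∈ c.zero i
    · simp [entry, h0, hx.zero i j h0]
    by_cases hi : i ∈ c.group
    · simp only [entry, h0, hi, if_true, if_false, one_mul, ite_self]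
      exact key i hi j
    · by_cases h1 : i = c.row ∧ j ∈ c.cols
      · obtain ⟨rfl, hj⟩ := h1
        simp only [entry, h0, hi, hj, if_true, if_false, and_self]
        have := hx.row i₀ hi₀ j hj j₁ hj₁
        rw [← hu₁] at this
        calc x (c.row, j) = x (c.row, j) * u₁ * ↑u₁⁻¹ := by rw [Units.mul_inv_cancel_right]
          _ = _ := by rw [this]; ring
      · simp [entry, h0, hi, h1]

/-- The parameters of `Config.entry`. -/
inductive Param (n a : ℕ)
  | scale (i : Fin n)
  | common
  | col (j : Fin (a + 1))
  | free (p : Fin n × Fin (a + 1))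

open MvPolynomial in
/-- The coordinates of the generic point that obeys the configuration. -/
noncomputable def generic (k : Type*) [Field k] (c : Config n a) (p : Fin n × Fin (a + 1)) :
    MvPolynomial (Param n a) k :=
  c.entry (fun i => X (.scale i)) (X .common) (fun j => X (.col j)) (fun p => X (.free p)) p

/-- The ideal of the closure of the set of points that obey the configuration. -/
noncomputable def ideal (k : Type*) [Field k] (c : Config n a) : Ideal (CoxRing k n a) :=
  RingHom.ker (MvPolynomial.aeval (R := k) (c.generic k))

/-! ### The ideal of a configuration and its equations at ring-valued points -/

section Ideal

variable {k : Type*} [Field k] {c : Config n a}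

instance : (c.ideal k).IsPrime := RingHom.ker_isPrime _

theorem isMultigraded_ideal (c : Config n a) : IsMultigraded (c.ideal k) := by
  -- Only the scaling parameters and the free coordinates carry weight, so every nonzero entry for
  -- `(i, j)` has degree `eᵢ`.
  refine isMultigraded_ker_aeval (fun
    | .scale i => Pi.single i 1
    | .common => 0
    | .col _ => 0
    | .free p => Pi.single p.1 1) _ fun p => ?_
  unfold generic entry
  have hX := fun q => MvPolynomial.isWeightedHomogeneous_X k (fun
    | .scale i => Pi.single i 1
    | .common => 0
    | .col _ => 0
    | .free p => Pi.single p.1 1 : Param n a → (Fin n → ℕ)) q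
  have h0 : multidegree n a p = Pi.single p.1 1 + (0 + 0) := by simp [multidegree]
  have h1 : multidegree n a p = Pi.single p.1 1 + 0 := by simp [multidegree]
  split_ifs
  · exact MvPolynomial.isWeightedHomogeneous_zero _ _ _
  · rw [h0]; exact (hX (.scale p.1)).mul ((hX .common).mul (hX (.col p.2)))
  · rw [h1]; exact (hX (.scale p.1)).mul (hX (.col p.2))
  · rw [h1]; exact (hX (.scale p.1)).mul (hX (.col p.2))
  · exact hX (.free p)

/-- A polynomial that does not vanish at some point given by parameters is not in the ideal. -/
theorem notMem_ideal {f : CoxRing k n a} (t : Fin n → k) (s : k) (v : Fin (a + 1) → k)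
    (w : Fin n × Fin (a + 1) → k) (hf : MvPolynomial.aeval (c.entry t s v w) f ≠ 0) :
    f ∉ c.ideal k := by
  intro h
  rw [ideal, RingHom.mem_ker] at h
  apply hf
  let φ : MvPolynomial (Param n a) k →ₐ[k] k := MvPolynomial.aeval fun
    | .scale i => t i
    | .common => s
    | .col j => v j
    | .free p => w p
  have : (MvPolynomial.aeval (c.entry t s v w) : CoxRing k n a →ₐ[k] k) =
      φ.comp (MvPolynomial.aeval (c.generic k)) := by
    ext p
    rw [AlgHom.comp_apply, MvPolynomial.aeval_X, MvPolynomial.aeval_X, generic]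
    refine Eq.trans ?_ (map_entry (φ : MvPolynomial (Param n a) k →+* k) c _ _ _ _ p).symm
    congr 1 <;> first | (funext q; simp [φ]) | simp [φ]
  rw [this, AlgHom.comp_apply, h, map_zero]

theorem X_notMem_ideal {i : Fin n} {j : Fin (a + 1)} (h : j ∉ c.zero i) :
    (MvPolynomial.X (i, j) : CoxRing k n a) ∉ c.ideal k := by
  refine notMem_ideal (fun _ => 1) 1 (fun _ => 1) (fun _ => 1) ?_
  rw [MvPolynomial.aeval_X]
  simp [entry, h]

theorem Valid.sat_generic (hc : c.Valid) : c.Sat (c.generic k) := by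
  unfold generic
  exact hc.sat_entry _ _ _ _

theorem Valid.sat_of_ideal_le {B : Type*} [CommRing B] (hc : c.Valid)
    (π : CoxRing k n a →+* B) (hπ : c.ideal k ≤ RingHom.ker π) :
    c.Sat fun p => π (MvPolynomial.X p) := by
  have h : c.Sat (c.generic k) := hc.sat_generic
  have hz : ∀ f : CoxRing k n a, MvPolynomial.aeval (c.generic k) f = 0 → π f = 0 :=
    fun f hf => RingHom.mem_ker.1 (hπ (RingHom.mem_ker.2 hf : f ∈ c.ideal k))
  constructor
  · intro i j hj
    exact hz _ ((MvPolynomial.aeval_X _ _).trans (h.zero i j hj))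
  · intro i hi i' hi' j j'
    rw [← map_mul, ← map_mul, ← sub_eq_zero, ← map_sub]
    exact hz _ (by simp only [map_sub, map_mul, MvPolynomial.aeval_X,
      h.group i hi i' hi' j j', sub_self])
  · intro i hi j hj j' hj'
    rw [← map_mul, ← map_mul, ← sub_eq_zero, ← map_sub]
    exact hz _ (by simp only [map_sub, map_mul, MvPolynomial.aeval_X,
      h.row i hi j hj j' hj', sub_self])

/-- The parameters supplied by `Sat.exists_entry` define an evaluation through which `π` factors via
the generic point. Without units the equations need not imply all the relations of the ideal. -/
theorem Sat.ideal_le_ker {B : Type*} [CommRing B] {π : CoxRing k n a →+* B}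
    (hx : c.Sat fun p => π (MvPolynomial.X p))
    (hu : c.group.Nonempty → ∃ i ∈ c.group, (∃ j, IsUnit (π (MvPolynomial.X (i, j)))) ∧
      ((∀ j ∈ c.cols, π (MvPolynomial.X (i, j)) = 0) ∨
        ∃ j ∈ c.cols, IsUnit (π (MvPolynomial.X (i, j))))) :
    c.ideal k ≤ RingHom.ker π := by
  obtain ⟨t, s, v, h⟩ := hx.exists_entry hu
  let ψ : MvPolynomial (Param n a) k →+* B := MvPolynomial.eval₂Hom (π.comp MvPolynomial.C) fun
    | .scale i => t i
    | .common => s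
    | .col j => v j
    | .free p => π (MvPolynomial.X p)
  have hψ : π = ψ.comp (MvPolynomial.aeval (c.generic k)).toRingHom := by
    refine MvPolynomial.ringHom_ext (fun r => ?_) fun p => ?_
    · simp [ψ]
    · rw [h p]
      simp only [AlgHom.toRingHom_eq_coe, RingHom.coe_comp, Function.comp_apply, RingHom.coe_coe,
        MvPolynomial.aeval_X, generic, map_entry]
      congr 1 <;> first | (funext q; simp [ψ]) | simp [ψ]
  intro f hf
  rw [ideal, RingHom.mem_ker] at hf
  rw [RingHom.mem_ker, hψ]
  exact (congrArg ψ hf).trans (map_zero ψ)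

/-- At points where all the coordinates that can be nonzero are units, the equations of a
configuration define its ideal. -/
theorem Valid.ideal_le_ker_of_isUnit {B : Type*} [CommRing B] (hc : c.Valid)
    (π : CoxRing k n a →+* B) (hx : c.Sat fun p => π (MvPolynomial.X p))
    (hu : ∀ i, ∀ j ∉ c.zero i, IsUnit (π (MvPolynomial.X (i, j)))) :
    c.ideal k ≤ RingHom.ker π := by
  refine hx.ideal_le_ker fun ⟨i, hi⟩ => ⟨i, hi, (hc.exists_notMem i).imp (hu i), ?_⟩
  rcases c.cols.eq_empty_or_nonempty with h | ⟨j, hj⟩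
  · exact .inl (by simp [h])
  · exact .inr ⟨j, hj, hu i j (hc.notMem_zero j hj i hi)⟩

theorem Sat.ideal_le_ker_field {F : Type*} [Field F]
    {π : CoxRing k n a →+* F} (hx : c.Sat fun p => π (MvPolynomial.X p))
    (hrel : ∀ i, ∃ j, π (MvPolynomial.X (i, j)) ≠ 0) :
    c.ideal k ≤ RingHom.ker π := by
  refine hx.ideal_le_ker fun ⟨i, hi⟩ =>
    ⟨i, hi, (hrel i).imp fun _ h => h.isUnit, ?_⟩
  by_cases h : ∀ j ∈ c.cols, π (MvPolynomial.X (i, j)) = 0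
  · exact .inl h
  · push Not at h
    exact .inr (h.imp fun j hj => ⟨hj.1, hj.2.isUnit⟩)

/-- The subvariety of the points that obey the configuration. -/
noncomputable def subvariety (k : Type*) [Field k] (c : Config n a) (hc : c.Valid) :
    Subvariety k n a where
  ideal := c.ideal k
  isPrime := inferInstance
  isMultigraded := c.isMultigraded_ideal
  relevant i := (hc.exists_notMem i).imp fun _ => X_notMem_ideal

theorem Sat.ideal_le_of_prime {P : Ideal (CoxRing k n a)} [P.IsPrime]
    (hx : c.Sat fun p => algebraMap (CoxRing k n a) P.ResidueField (MvPolynomial.X p))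
    (hrel : ∀ i, ∃ j, (MvPolynomial.X (i, j) : CoxRing k n a) ∉ P) : c.ideal k ≤ P := by
  rw [← Ideal.ker_algebraMap_residueField P]
  refine hx.ideal_le_ker_field fun i => (hrel i).imp fun j hj h => hj ?_
  rwa [← RingHom.mem_ker, Ideal.ker_algebraMap_residueField] at h

end Ideal

end Config

/-! ### Components and multiplicities of divisors on configurations -/

namespace Config

universe u

variable {k : Type u} [Field k] {n a : ℕ}

theorem X_mem_ideal {c : Config n a} {i : Fin n} {j : Fin (a + 1)} (h : j ∈ c.zero i) :
    (MvPolynomial.X (i, j) : CoxRing k n a) ∈ c.ideal k := by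
  rw [ideal, RingHom.mem_ker, MvPolynomial.aeval_X]
  simp [generic, entry, h]

theorem ideal_ne {c c' : Config n a} (i : Fin n) (j : Fin (a + 1))
    (h : j ∈ c.zero i ↔ j ∉ c'.zero i) : c.ideal k ≠ c'.ideal k := by
  intro he
  by_cases hj : j ∈ c.zero i
  · exact X_notMem_ideal (h.1 hj) (he ▸ X_mem_ideal (k := k) hj)
  · exact X_notMem_ideal hj (he.symm ▸ X_mem_ideal (k := k) (not_not.1 fun h' => hj (h.2 h')))

/-- The configuration `c` describes a component of the divisor of `g` on the subvariety of the
configuration `V`, of multiplicity one. -/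
structure IsComponent (V : Config n a) (g : CoxRing k n a) (c : Config n a) : Prop where
  valid : c.Valid
  sat_of_sat : ∀ {B : Type u} [CommRing B] (π : CoxRing k n a →+* B),
    c.Sat (fun p => π (MvPolynomial.X p)) → V.Sat (fun p => π (MvPolynomial.X p)) ∧ π g = 0
  sat_of_isUnit : ∀ {B : Type u} [CommRing B] (π : CoxRing k n a →+* B),
    (∀ f ∉ c.ideal k, IsUnit (π f)) → V.Sat (fun p => π (MvPolynomial.X p)) → π g = 0 →
      c.Sat (fun p => π (MvPolynomial.X p))

/-- This reduces a divisor to equations. The field `sat_of_sat` of `IsComponent` places each listed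
variety inside the divisor, `sat_of_isUnit` gives it multiplicity one, and `hcov`, applied to
residue fields, excludes further components. -/
theorem divisor_subvariety {V : Config n a} (hV : V.Valid) {g : CoxRing k n a}
    (Q : List (Config n a)) (hQ : ∀ c ∈ Q, V.IsComponent g c)
    (hne : Q.Pairwise fun c c' => c.ideal k ≠ c'.ideal k)
    (hcov : ∀ {F : Type u} [Field F] (π : CoxRing k n a →+* F),
      (∀ i, ∃ j, π (MvPolynomial.X (i, j)) ≠ 0) → V.Sat (fun p => π (MvPolynomial.X p)) →
        π g = 0 → ∃ c ∈ Q, c.Sat (fun p => π (MvPolynomial.X p))) :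
    divisor (V.subvariety k hV) g = (Q.map fun c => fundamentalCycle (c.ideal k)).sum := by
  classical
  have hval : ∀ c ∈ Q, c.Valid := fun c hc => (hQ c hc).valid
  have hJ : ∀ {B : Type u} [CommRing B] (π : CoxRing k n a →+* B),
      V.ideal k ⊔ Ideal.span {g} ≤ RingHom.ker π →
        V.Sat (fun p => π (MvPolynomial.X p)) ∧ π g = 0 := fun π h =>
    ⟨hV.sat_of_ideal_le π (le_sup_left.trans h),
      h (Ideal.mem_sup_right (Ideal.mem_span_singleton_self g))⟩
  let L : List (Subvariety k n a) := Q.pmap (fun c hc => c.subvariety k hc) hval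
  have hL : ∀ W ∈ L, ∃ c ∈ Q, W.ideal = c.ideal k := by
    intro W hW
    obtain ⟨c, hc, rfl⟩ := List.mem_pmap.1 hW
    exact ⟨c, hc, rfl⟩
  have hnd : L.Nodup := by
    refine List.Pairwise.pmap hne _ fun c hc c' hc' h he => h ?_
    exact congrArg Subvariety.ideal he
  have hsum : (Q.map fun c => fundamentalCycle (c.ideal k)).sum =
      ∑ W ∈ L.toFinset, Finsupp.single W 1 := by
    rw [List.sum_toFinset _ hnd, List.map_pmap, ← List.pmap_eq_map (H := hval)]
    congr 1
    refine List.pmap_congr_left _ fun c _ hc _ => ?_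
    exact fundamentalCycle_ideal (c.subvariety k hc)
  rw [hsum]
  refine fundamentalCycle_eq_sum _ _ (fun W hW => ?_) (fun W hW f hf => ?_) fun W hW => ?_
  · obtain ⟨c, hc, hWc⟩ := hL W (List.mem_toFinset.1 hW)
    have hle : c.ideal k ≤ RingHom.ker (algebraMap (CoxRing k n a) W.ideal.ResidueField) := by
      rw [Ideal.ker_algebraMap_residueField, hWc]
    obtain ⟨hs, hg⟩ := (hQ c hc).sat_of_sat _ ((hval c hc).sat_of_ideal_le _ hle)
    refine sup_le (hs.ideal_le_of_prime W.relevant) ?_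
    rwa [Ideal.span_singleton_le_iff_mem, ← Ideal.ker_algebraMap_residueField W.ideal]
  · obtain ⟨c, hc, hWc⟩ := hL W (List.mem_toFinset.1 hW)
    set I := (V.ideal k ⊔ Ideal.span {g}).map
      (algebraMap (CoxRing k n a) (Localization.AtPrime W.ideal)) with hI
    -- `B` is the local ring at `W` modulo the extended ideal `I`. Killing `c.ideal k` in `B` is
    -- exactly the local agreement that is needed.
    obtain ⟨B, _, π, hπ, hunit⟩ : ∃ (B : Type u) (_ : CommRing B) (π : CoxRing k n a →+* B),
        (∀ q, π q = 0 ↔ algebraMap (CoxRing k n a) (Localization.AtPrime W.ideal) q ∈ I) ∧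
          ∀ q ∉ c.ideal k, IsUnit (π q) :=
      ⟨Localization.AtPrime W.ideal ⧸ I, Ideal.Quotient.commRing I,
        (Ideal.Quotient.mk I).comp
          (algebraMap (CoxRing k n a) (Localization.AtPrime W.ideal)),
        fun q => Ideal.Quotient.eq_zero_iff_mem,
        fun q hq => (IsLocalization.map_units (Localization.AtPrime W.ideal)
          (⟨q, fun h => hq (hWc ▸ h)⟩ : W.ideal.primeCompl)).map (Ideal.Quotient.mk I)⟩
    obtain ⟨hs, hg⟩ := hJ π fun q hq => (hπ q).2 (Ideal.mem_map_of_mem _ hq)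
    have := (hval c hc).ideal_le_ker_of_isUnit π ((hQ c hc).sat_of_isUnit π hunit hs hg)
      fun i j hj => hunit _ (X_notMem_ideal hj)
    exact (hπ f).1 (this (hWc ▸ hf))
  · have hle : V.ideal k ⊔ Ideal.span {g} ≤
        RingHom.ker (algebraMap (CoxRing k n a) W.ideal.ResidueField) := by
      rw [Ideal.ker_algebraMap_residueField]; exact hW
    obtain ⟨hs, hg⟩ := hJ _ hle
    obtain ⟨c, hc, hcs⟩ := hcov _ (fun i => (W.relevant i).imp fun j hj h => hj (by
      rwa [← RingHom.mem_ker, Ideal.ker_algebraMap_residueField] at h)) hs hg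
    exact ⟨c.subvariety k (hval c hc), List.mem_toFinset.2 (List.mem_pmap.2 ⟨c, hc, rfl⟩),
      hcs.ideal_le_of_prime W.relevant⟩

end Config

/-! ### The degeneration relation between partial diagonals -/

namespace Config

universe u

variable {n a : ℕ}

/-- The class in the Chow group of the subvariety of the points that obey a configuration. -/
noncomputable def cls (k : Type*) [Field k] (c : Config n a) : Chow k n a :=
  chowClass (fundamentalCycle (c.ideal k))

/-- Require in addition that the coordinates with index `m` be proportional. -/
def addCol (c : Config n a) (m : Fin (a + 1)) : Config n a :=
  { c with cols := insert m c.cols }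

/-- Require in addition that the coordinates in `cols` of the point `x_row` vanish. -/
def zeroRow (c : Config n a) : Config n a :=
  { c with zero := Function.update c.zero c.row (c.zero c.row ∪ c.cols), cols := ∅ }

/-- Require in addition that the coordinates with index `m` of the points in the group vanish. -/
def zeroGroup (c : Config n a) (m : Fin (a + 1)) : Config n a :=
  { c with zero := fun i => if i ∈ c.group then insert m (c.zero i) else c.zero i }

/-- Require in addition that the coordinates with index `j ∈ cols` vanish. -/
def zeroCol (c : Config n a) (j : Fin (a + 1)) : Config n a :=
  { c with
    zero := fun i => if i = c.row ∨ i ∈ c.group then insert j (c.zero i) else c.zero i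
    cols := c.cols.erase j }

section ZeroRow

variable {B : Type*} [CommRing B] {c : Config n a} {x : Fin n × Fin (a + 1) → B}

theorem Sat.zeroRow (hx : c.Sat x) (hr : ∀ l ∈ c.cols, x (c.row, l) = 0) : c.zeroRow.Sat x where
  zero i' l hl := by
    by_cases hi : i' = c.row
    · subst hi
      simp only [Config.zeroRow, Function.update_self, Finset.mem_union] at hl
      exact hl.elim (hx.zero _ l) (hr l)
    · simp only [Config.zeroRow, ne_eq, hi, not_false_eq_true, Function.update_of_ne] at hl
      exact hx.zero i' l hl
  group := hx.group
  row i' _ l hl := by simp [Config.zeroRow] at hl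

theorem Sat.of_zeroRow (hx : c.zeroRow.Sat x) : c.Sat x ∧ ∀ l ∈ c.cols, x (c.row, l) = 0 := by
  have h0 : ∀ l ∈ c.cols, x (c.row, l) = 0 := fun l hl =>
    hx.zero c.row l (by simp [Config.zeroRow, hl])
  refine ⟨⟨fun i' l hl => hx.zero i' l ?_, hx.group, fun i' _ l hl l' hl' => ?_⟩, h0⟩
  · by_cases hi : i' = c.row
    · subst hi
      simp [Config.zeroRow, hl]
    · simpa [Config.zeroRow, hi] using hl
  · rw [h0 l hl, h0 l' hl', zero_mul, zero_mul]

end ZeroRow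

/-- The assumptions under which the column `m` can be added to the configuration `c`. -/
structure Addable (c : Config n a) (i : Fin n) (j m : Fin (a + 1)) : Prop where
  valid : c.Valid
  row_notMem : c.row ∉ c.group
  mem_group : i ∈ c.group
  mem_cols : j ∈ c.cols
  notMem_cols : m ∉ c.cols
  notMem_zero_row : m ∉ c.zero c.row
  notMem_zero : m ∉ c.zero i

namespace Addable

variable {c : Config n a} {i : Fin n} {j m : Fin (a + 1)} (h : c.Addable i j m)

include h

theorem notMem_zero' {i' : Fin n} (hi' : i' ∈ c.group) : m ∉ c.zero i' :=
  h.valid.zero_eq i h.mem_group i' hi' ▸ h.notMem_zero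

theorem ne : m ≠ j := fun he => h.notMem_cols (he ▸ h.mem_cols)

theorem valid_addCol : (c.addCol m).Valid where
  zero_eq := h.valid.zero_eq
  row_notMem := .inl h.row_notMem
  notMem_zero_row l hl := by
    rcases Finset.mem_insert.1 hl with rfl | hl
    exacts [h.notMem_zero_row, h.valid.notMem_zero_row l hl]
  notMem_zero l hl i' hi' := by
    rcases Finset.mem_insert.1 hl with rfl | hl
    exacts [h.notMem_zero' hi', h.valid.notMem_zero l hl i' hi']
  exists_notMem := h.valid.exists_notMem

theorem valid_zeroRow : c.zeroRow.Valid where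
  zero_eq i₁ hi₁ i₂ hi₂ := by
    have h₁ : i₁ ≠ c.row := fun he => h.row_notMem (he ▸ hi₁)
    have h₂ : i₂ ≠ c.row := fun he => h.row_notMem (he ▸ hi₂)
    simpa [zeroRow, h₁, h₂] using h.valid.zero_eq i₁ hi₁ i₂ hi₂
  row_notMem := .inr rfl
  notMem_zero_row l hl := by simp [zeroRow] at hl
  notMem_zero l hl := by simp [zeroRow] at hl
  exists_notMem i' := by
    by_cases hi : i' = c.row
    · subst hi
      exact ⟨m, by simp [zeroRow, h.notMem_zero_row, h.notMem_cols]⟩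
    · simpa [zeroRow, hi] using h.valid.exists_notMem i'

theorem valid_zeroGroup : (c.zeroGroup m).Valid where
  zero_eq i₁ hi₁ i₂ hi₂ := by
    have h₁ : i₁ ∈ c.group := hi₁
    have h₂ : i₂ ∈ c.group := hi₂
    simp [zeroGroup, h₁, h₂, h.valid.zero_eq i₁ hi₁ i₂ hi₂]
  row_notMem := .inl h.row_notMem
  notMem_zero_row l hl := by
    simpa [zeroGroup, h.row_notMem] using h.valid.notMem_zero_row l hl
  notMem_zero l hl i' hi' := by
    have hl' : l ∈ c.cols := hl
    have h' : i' ∈ c.group := hi'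
    have : l ≠ m := fun he => h.notMem_cols (he ▸ hl')
    simpa [zeroGroup, h', this] using h.valid.notMem_zero l hl' i' h'
  exists_notMem i' := by
    by_cases hi : i' ∈ c.group
    · refine ⟨j, ?_⟩
      simpa [zeroGroup, hi, h.ne.symm] using h.valid.notMem_zero j h.mem_cols i' hi
    · simpa [zeroGroup, hi] using h.valid.exists_notMem i'

theorem valid_zeroCol : (c.zeroCol j).Valid where
  zero_eq i₁ hi₁ i₂ hi₂ := by
    have h₁ : i₁ ∈ c.group := hi₁
    have h₂ : i₂ ∈ c.group := hi₂
    simp [zeroCol, h₁, h₂, h.valid.zero_eq i₁ hi₁ i₂ hi₂]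
  row_notMem := .inl h.row_notMem
  notMem_zero_row l hl := by
    have hl' := Finset.mem_erase.1 hl
    simpa [zeroCol, hl'.1] using h.valid.notMem_zero_row l hl'.2
  notMem_zero l hl i' hi' := by
    have hl' := Finset.mem_erase.1 hl
    have h' : i' ∈ c.group := hi'
    simpa [zeroCol, hl'.1, h'] using h.valid.notMem_zero l hl'.2 i' h'
  exists_notMem i' := by
    by_cases hi : i' ∈ c.group
    · exact ⟨m, by simp [zeroCol, hi, h.ne, h.notMem_zero' hi]⟩
    · by_cases hr : i' = c.row
      · subst hr
        exact ⟨m, by simp [zeroCol, h.ne, h.notMem_zero_row]⟩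
      · simpa [zeroCol, hi, hr] using h.valid.exists_notMem i'

section Sat

variable {B : Type*} [CommRing B] {x : Fin n × Fin (a + 1) → B}

/-- If `x_{i,j}` can be cancelled, one minor gives all those that involve the column `m`. -/
theorem sat_addCol (hx : c.Sat x) (hreg : ∀ y z, y * x (i, j) = z * x (i, j) → y = z)
    (hm : x (c.row, j) * x (i, m) = x (c.row, m) * x (i, j)) : (c.addCol m).Sat x where
  zero := hx.zero
  group := hx.group
  row i' hi' := by
    have hi : i' ∈ c.group := hi'
    have key : ∀ l ∈ c.cols, x (c.row, l) * x (i', m) = x (c.row, m) * x (i', l) := by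
      intro l hl
      apply hreg
      have e1 := hx.row i h.mem_group l hl j h.mem_cols
      have e2 := hx.group i h.mem_group i' hi m l
      calc x (c.row, l) * x (i', m) * x (i, j)
          = (x (c.row, l) * x (i, j)) * x (i', m) := by ring
        _ = x (c.row, j) * (x (i, l) * x (i', m)) := by rw [e1]; ring
        _ = (x (c.row, j) * x (i, m)) * x (i', l) := by rw [← e2]; ring
        _ = _ := by rw [hm]; ring
    intro l hl l' hl'
    rcases Finset.mem_insert.1 hl with rfl | hl <;> rcases Finset.mem_insert.1 hl' with rfl | hl'
    · rfl
    · exact (key l' hl').symm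
    · exact key l (by assumption)
    · exact hx.row i' hi l hl l' hl'

theorem sat_zeroGroup (hx : c.Sat x) (hm : ∀ i' ∈ c.group, x (i', m) = 0) :
    (c.zeroGroup m).Sat x where
  zero i' l hl := by
    by_cases hi : i' ∈ c.group
    · simp only [zeroGroup, hi, if_true, Finset.mem_insert] at hl
      rcases hl with rfl | hl
      exacts [hm i' hi, hx.zero i' l hl]
    · simp only [zeroGroup, hi, if_false] at hl
      exact hx.zero i' l hl
  group := hx.group
  row := hx.row

theorem sat_zeroCol (hx : c.Sat x) (hr : x (c.row, j) = 0) (hj : ∀ i' ∈ c.group, x (i', j) = 0) :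
    (c.zeroCol j).Sat x where
  zero i' l hl := by
    by_cases hi : i' = c.row ∨ i' ∈ c.group
    · simp only [zeroCol, hi, if_true, Finset.mem_insert] at hl
      rcases hl with rfl | hl
      · rcases hi with rfl | hi
        exacts [hr, hj i' hi]
      · exact hx.zero i' l hl
    · simp only [zeroCol, hi, if_false] at hl
      exact hx.zero i' l hl
  group := hx.group
  row i' hi' l hl l' hl' :=
    hx.row i' hi' l (Finset.mem_of_mem_erase hl) l' (Finset.mem_of_mem_erase hl')

theorem sat_of_addCol (hx : (c.addCol m).Sat x) :
    c.Sat x ∧ x (c.row, j) * x (i, m) = x (c.row, m) * x (i, j) :=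
  ⟨⟨hx.zero, hx.group, fun i' hi' l hl l' hl' => hx.row i' hi' l (Finset.mem_insert_of_mem hl) l'
    (Finset.mem_insert_of_mem hl')⟩, hx.row i h.mem_group j (Finset.mem_insert_of_mem h.mem_cols)
      m (Finset.mem_insert_self _ _)⟩

theorem sat_of_zeroGroup (hx : (c.zeroGroup m).Sat x) : c.Sat x ∧ x (i, m) = 0 := by
  refine ⟨⟨fun i' l hl => hx.zero i' l ?_, hx.group, hx.row⟩,
    hx.zero i m (by simp [zeroGroup, h.mem_group])⟩
  simp only [zeroGroup]
  split_ifs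
  exacts [Finset.mem_insert_of_mem hl, hl]

theorem sat_of_zeroCol (hx : (c.zeroCol j).Sat x) :
    c.Sat x ∧ x (c.row, j) = 0 ∧ x (i, j) = 0 := by
  have hr : x (c.row, j) = 0 := hx.zero c.row j (by simp [zeroCol])
  have hg : ∀ i' ∈ c.group, x (i', j) = 0 := fun i' hi' =>
    hx.zero i' j (by simp [zeroCol, hi'])
  refine ⟨⟨fun i' l hl => hx.zero i' l ?_, hx.group, fun i' hi' l hl l' hl' => ?_⟩, hr,
    hg i h.mem_group⟩
  · simp only [zeroCol]
    split_ifs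
    exacts [Finset.mem_insert_of_mem hl, hl]
  · by_cases e : l = j
    · rw [e, hr, hg i' hi', zero_mul, mul_zero]
    · by_cases e' : l' = j
      · rw [e', hr, hg i' hi', zero_mul, mul_zero]
      · exact hx.row i' hi' l (Finset.mem_erase.2 ⟨e, hl⟩) l' (Finset.mem_erase.2 ⟨e', hl'⟩)

/-- A coordinate that vanishes on one point of the group vanishes on the whole group. -/
theorem eq_zero_of_group (hx : c.Sat x) {l l' : Fin (a + 1)}
    (hreg : ∀ y, y * x (i, l') = 0 → y = 0) (h0 : x (i, l) = 0) (i' : Fin n)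
    (hi' : i' ∈ c.group) : x (i', l) = 0 := by
  apply hreg
  rw [hx.group i' hi' i h.mem_group l l', h0, mul_zero]

end Sat

open MvPolynomial (X)

variable {k : Type u} [Field k]

theorem minor_notMem {j' : Fin (a + 1)} (hj' : j' ∈ c.cols) (hne : j' ≠ j) :
    (X (c.row, j') * X (i, m) - X (c.row, m) * X (i, j') : CoxRing k n a) ∉
      (c.zeroCol j).ideal k := by
  -- The entry `x_{row,m}` is free because `m` is not a column. Setting it to `0` and the other
  -- entries of the minor to `1` gives the value `1`.
  refine notMem_ideal (fun _ => 1) 1 (fun _ => 1) (fun _ => 0) ?_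
  have hm := h.notMem_cols
  simp [entry, zeroCol, h.row_notMem, h.mem_group, hj', hne, h.ne, h.notMem_zero_row, h.notMem_zero,
    hm, h.valid.notMem_zero_row j' hj', h.valid.notMem_zero j' hj' i h.mem_group]

theorem minor_notMem_self :
    (X (c.row, j) * X (i, m) - X (c.row, m) * X (i, j) : CoxRing k n a) ∉ c.ideal k := by
  refine notMem_ideal (fun _ => 1) 1 (fun _ => 1) (fun _ => 0) ?_
  have hm := h.notMem_cols
  have hj := h.mem_cols
  simp [entry, h.row_notMem, h.mem_group, hj, h.notMem_zero_row, h.notMem_zero,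
    hm, h.valid.notMem_zero_row j hj, h.valid.notMem_zero j hj i h.mem_group]

theorem isComponent_addCol :
    c.IsComponent (X (c.row, j) * X (i, m) - X (c.row, m) * X (i, j) : CoxRing k n a)
      (c.addCol m) where
  valid := h.valid_addCol
  sat_of_sat π hx := by
    obtain ⟨h1, h2⟩ := h.sat_of_addCol hx
    exact ⟨h1, by rw [map_sub, map_mul, map_mul, h2, sub_self]⟩
  sat_of_isUnit π hu hx hg := by
    have hij : IsUnit (π (X (i, j))) :=
      hu _ (X_notMem_ideal (h.valid.notMem_zero j h.mem_cols i h.mem_group))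
    refine h.sat_addCol hx (fun y z => hij.mul_right_cancel) ?_
    rw [map_sub, map_mul, map_mul] at hg
    exact sub_eq_zero.1 hg

theorem sat_zeroCol_of_isUnit {B : Type*} [CommRing B] {π : CoxRing k n a →+* B}
    {j' : Fin (a + 1)} (hj' : j' ∈ c.cols) (hne : j' ≠ j)
    (hu : ∀ f ∉ (c.zeroCol j).ideal k, IsUnit (π f)) (hx : c.Sat fun p => π (X p))
    (h0 : π (X (i, j)) = 0) : (c.zeroCol j).Sat fun p => π (X p) := by
  have hu' : IsUnit (π (X (i, j'))) := hu _ (X_notMem_ideal (by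
    simp [zeroCol, h.mem_group, hne, h.valid.notMem_zero j' hj' i h.mem_group]))
  refine h.sat_zeroCol hx ?_ (h.eq_zero_of_group hx (fun y => hu'.mul_left_eq_zero.1) h0)
  have := hx.row i h.mem_group j h.mem_cols j' hj'
  simp only [h0, mul_zero] at this
  exact hu'.mul_left_eq_zero.1 this

/-- Multiplicity one holds because `x_{i,j}` times the minor in the columns `j'` and `m` lies in the
ideal generated by `g` and the column relations, while that minor is a unit along the component. -/
theorem isComponent_minor_zeroCol {j' : Fin (a + 1)} (hj' : j' ∈ c.cols) (hne : j' ≠ j) :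
    c.IsComponent (X (c.row, j) * X (i, m) - X (c.row, m) * X (i, j) : CoxRing k n a)
      (c.zeroCol j) where
  valid := h.valid_zeroCol
  sat_of_sat π hx := by
    obtain ⟨h1, h2, h3⟩ := h.sat_of_zeroCol hx
    exact ⟨h1, by rw [map_sub, map_mul, map_mul, h2, h3, zero_mul, mul_zero, sub_self]⟩
  sat_of_isUnit π hu hx hg := by
    refine h.sat_zeroCol_of_isUnit hj' hne hu hx
      ((hu _ (h.minor_notMem hj' hne)).mul_left_eq_zero.1 ?_)
    have e := hx.row i h.mem_group j h.mem_cols j' hj'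
    simp only [map_sub, map_mul] at hg e ⊢
    linear_combination π (X (i, j')) * hg - π (X (i, m)) * e

theorem isComponent_mul_zeroCol {j' : Fin (a + 1)} (hj' : j' ∈ c.cols) (hne : j' ≠ j) :
    c.IsComponent (X (c.row, j) * X (i, m) : CoxRing k n a) (c.zeroCol j) where
  valid := h.valid_zeroCol
  sat_of_sat π hx := by
    obtain ⟨h1, h2, h3⟩ := h.sat_of_zeroCol hx
    exact ⟨h1, by rw [map_mul, h2, zero_mul]⟩
  sat_of_isUnit π hu hx hg := by
    have hm : IsUnit (π (X (i, m))) := hu _ (X_notMem_ideal (by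
      simp [zeroCol, h.mem_group, h.ne, h.notMem_zero]))
    have hj : IsUnit (π (X (c.row, j'))) := hu _ (X_notMem_ideal (by
      simp [zeroCol, hne, h.valid.notMem_zero_row j' hj']))
    rw [map_mul] at hg
    have hr := hm.mul_left_eq_zero.1 hg
    refine h.sat_zeroCol_of_isUnit hj' hne hu hx (hj.mul_right_eq_zero.1 ?_)
    have e := hx.row i h.mem_group j h.mem_cols j' hj'
    rw [← e, hr, zero_mul]

theorem isComponent_mul_zeroRow :
    c.IsComponent (X (c.row, j) * X (i, m) : CoxRing k n a) c.zeroRow where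
  valid := h.valid_zeroRow
  sat_of_sat π hx := by
    obtain ⟨h1, h2⟩ := hx.of_zeroRow
    exact ⟨h1, by rw [map_mul, h2 j h.mem_cols, zero_mul]⟩
  sat_of_isUnit π hu hx hg := by
    have hi : i ≠ c.row := fun he => h.row_notMem (he ▸ h.mem_group)
    have hm : IsUnit (π (X (i, m))) := hu _ (X_notMem_ideal (by
      simp [zeroRow, hi, h.notMem_zero]))
    have hj : IsUnit (π (X (i, j))) := hu _ (X_notMem_ideal (by
      simp [zeroRow, hi, h.valid.notMem_zero j h.mem_cols i h.mem_group]))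
    rw [map_mul] at hg
    have hr := hm.mul_left_eq_zero.1 hg
    refine hx.zeroRow fun l hl => hj.mul_left_eq_zero.1 ?_
    rw [hx.row i h.mem_group l hl j h.mem_cols, hr, zero_mul]

theorem isComponent_mul_zeroGroup :
    c.IsComponent (X (c.row, j) * X (i, m) : CoxRing k n a) (c.zeroGroup m) where
  valid := h.valid_zeroGroup
  sat_of_sat π hx := by
    obtain ⟨h1, h2⟩ := h.sat_of_zeroGroup hx
    exact ⟨h1, by rw [map_mul, h2, mul_zero]⟩
  sat_of_isUnit π hu hx hg := by
    have hr : IsUnit (π (X (c.row, j))) := hu _ (X_notMem_ideal (by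
      simp [zeroGroup, h.row_notMem, h.valid.notMem_zero_row j h.mem_cols]))
    have hj : IsUnit (π (X (i, j))) := hu _ (X_notMem_ideal (by
      simp [zeroGroup, h.mem_group, h.ne.symm,
        h.valid.notMem_zero j h.mem_cols i h.mem_group]))
    rw [map_mul] at hg
    exact h.sat_zeroGroup hx (h.eq_zero_of_group hx (l' := j)
      (fun y => hj.mul_left_eq_zero.1) (hr.mul_right_eq_zero.1 hg))

section Field

variable {F : Type*} [Field F] {x : Fin n × Fin (a + 1) → F} (hrel : ∃ l, x (i, l) ≠ 0)
  (hx : c.Sat x)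

include hrel hx

theorem eq_zero_of_group_field {l : Fin (a + 1)} (h0 : x (i, l) = 0) :
    ∀ i' ∈ c.group, x (i', l) = 0 := by
  obtain ⟨l', hl'⟩ := hrel
  exact h.eq_zero_of_group hx (fun y hy => (mul_eq_zero.1 hy).resolve_right hl') h0

theorem sat_zeroCol_or_addCol (hg : x (c.row, j) * x (i, m) = x (c.row, m) * x (i, j)) :
    (x (c.row, j) = 0 ∧ x (i, j) = 0 ∧ (c.zeroCol j).Sat x) ∨ (c.addCol m).Sat x := by
  by_cases hi : x (i, j) = 0
  · by_cases hr : x (c.row, j) = 0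
    · exact .inl ⟨hr, hi, h.sat_zeroCol hx hr (h.eq_zero_of_group_field hrel hx hi)⟩
    -- Since `x_{row,j} ≠ 0` and `x_{i,j} = 0`, proportionality forces the group to vanish in all
    -- columns, including `m`; the new minors are then trivially zero.
    · have hz : ∀ l ∈ insert m c.cols, ∀ i' ∈ c.group, x (i', l) = 0 := by
        intro l hl
        refine h.eq_zero_of_group_field hrel hx ?_
        refine (mul_eq_zero.1 (?_ : x (c.row, j) * x (i, l) = 0)).resolve_left hr
        rcases Finset.mem_insert.1 hl with rfl | hl
        · rw [hg, hi, mul_zero]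
        · rw [hx.row i h.mem_group j h.mem_cols l hl, hi, mul_zero]
      exact .inr ⟨hx.zero, hx.group, fun i' hi' l hl l' hl' => by
        rw [hz l hl i' hi', hz l' hl' i' hi', mul_zero, mul_zero]⟩
  · exact .inr (h.sat_addCol hx (fun y z => mul_right_cancel₀ hi) hg)

theorem sat_of_mul_eq_zero (hg : x (c.row, j) * x (i, m) = 0) :
    (x (c.row, j) = 0 ∧ x (i, j) = 0 ∧ (c.zeroCol j).Sat x) ∨ c.zeroRow.Sat x ∨
      (c.zeroGroup m).Sat x := by
  rcases mul_eq_zero.1 hg with hr | hm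
  · by_cases hi : x (i, j) = 0
    · exact .inl ⟨hr, hi, h.sat_zeroCol hx hr (h.eq_zero_of_group_field hrel hx hi)⟩
    · refine .inr (.inl (hx.zeroRow fun l hl => ?_))
      refine (mul_eq_zero.1 (?_ : x (c.row, l) * x (i, j) = 0)).resolve_right hi
      rw [hx.row i h.mem_group l hl j h.mem_cols, hr, zero_mul]
  · exact .inr (.inr (h.sat_zeroGroup hx (h.eq_zero_of_group_field hrel hx hm)))

end Field

theorem zeroRow_ideal_ne : c.zeroRow.ideal k ≠ (c.zeroGroup m).ideal k :=
  ideal_ne c.row j (by simp [zeroRow, zeroGroup, h.mem_cols, h.row_notMem,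
    h.valid.notMem_zero_row j h.mem_cols])

/-- With a single column, the locus `x_{row,j} = x_{i,j} = 0` lies inside that of `c.addCol m`: the
group then vanishes at `j` as well, and all minors in the columns `j` and `m` are zero. -/
theorem divisor_minor_of_eq (hc : c.cols = {j}) :
    divisor (c.subvariety k h.valid) (X (c.row, j) * X (i, m) - X (c.row, m) * X (i, j)) =
      fundamentalCycle ((c.addCol m).ideal k) := by
  rw [divisor_subvariety h.valid [c.addCol m] (by simpa using h.isComponent_addCol) (by simp)]
  · simp
  · intro F _ π hrel hx hg
    refine ⟨c.addCol m, by simp, ?_⟩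
    simp only [map_sub, map_mul, sub_eq_zero] at hg
    rcases h.sat_zeroCol_or_addCol (hrel i) hx hg with ⟨hr, hi, -⟩ | hs
    · refine ⟨hx.zero, hx.group, fun i' hi' => ?_⟩
      have hj := h.eq_zero_of_group_field (hrel i) hx hi i' hi'
      have hr' : π (X ((c.addCol m).row, j)) = 0 := hr
      intro l hl l' hl'
      simp only [addCol, hc, Finset.mem_insert, Finset.mem_singleton] at hl hl'
      rcases hl with rfl | rfl <;> rcases hl' with rfl | rfl <;> simp [hj, hr']
    · exact hs

theorem divisor_minor {j' : Fin (a + 1)} (hj' : j' ∈ c.cols) (hne : j' ≠ j) :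
    divisor (c.subvariety k h.valid) (X (c.row, j) * X (i, m) - X (c.row, m) * X (i, j)) =
      fundamentalCycle ((c.addCol m).ideal k) + fundamentalCycle ((c.zeroCol j).ideal k) := by
  rw [divisor_subvariety h.valid [c.addCol m, c.zeroCol j]]
  · simp
  · simpa using ⟨h.isComponent_addCol, h.isComponent_minor_zeroCol hj' hne⟩
  · simpa using ideal_ne (k := k) (c := c.addCol m) (c' := c.zeroCol j) c.row j (by
      simp [addCol, zeroCol, h.valid.notMem_zero_row j h.mem_cols])
  · intro F _ π hrel hx hg
    simp only [map_sub, map_mul, sub_eq_zero] at hg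
    simpa using (h.sat_zeroCol_or_addCol (hrel i) hx hg).symm.imp_right fun h => h.2.2

/-- With a single column, the locus of `c.zeroCol j` lies inside that of `c.zeroRow`, so it
contributes no component. -/
theorem divisor_mul_of_eq (hc : c.cols = {j}) :
    divisor (c.subvariety k h.valid) (X (c.row, j) * X (i, m)) =
      fundamentalCycle (c.zeroRow.ideal k) + fundamentalCycle ((c.zeroGroup m).ideal k) := by
  rw [divisor_subvariety h.valid [c.zeroRow, c.zeroGroup m]]
  · simp
  · simpa using ⟨h.isComponent_mul_zeroRow, h.isComponent_mul_zeroGroup⟩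
  · simpa using h.zeroRow_ideal_ne
  · intro F _ π hrel hx hg
    rw [map_mul] at hg
    rcases h.sat_of_mul_eq_zero (hrel i) hx hg with ⟨hr, -⟩ | hs
    · exact ⟨c.zeroRow, by simp, hx.zeroRow (by simpa [hc] using hr)⟩
    · simpa using hs

theorem divisor_mul {j' : Fin (a + 1)} (hj' : j' ∈ c.cols) (hne : j' ≠ j) :
    divisor (c.subvariety k h.valid) (X (c.row, j) * X (i, m)) =
      fundamentalCycle (c.zeroRow.ideal k) + fundamentalCycle ((c.zeroGroup m).ideal k) +
        fundamentalCycle ((c.zeroCol j).ideal k) := by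
  have hi : i ≠ c.row := fun he => h.row_notMem (he ▸ h.mem_group)
  rw [divisor_subvariety h.valid [c.zeroRow, c.zeroGroup m, c.zeroCol j]]
  · simp [add_assoc]
  · simpa using ⟨h.isComponent_mul_zeroRow, h.isComponent_mul_zeroGroup,
      h.isComponent_mul_zeroCol hj' hne⟩
  · have h1 : c.zeroRow.ideal k ≠ (c.zeroCol j).ideal k := ideal_ne i j (by
      simp [zeroRow, zeroCol, hi, h.mem_group, h.valid.notMem_zero j h.mem_cols i h.mem_group])
    have h2 : (c.zeroGroup m).ideal k ≠ (c.zeroCol j).ideal k := ideal_ne c.row j (by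
      simp [zeroGroup, zeroCol, h.row_notMem, h.valid.notMem_zero_row j h.mem_cols])
    simpa using ⟨⟨h.zeroRow_ideal_ne, h1⟩, h2⟩
  · intro F _ π hrel hx hg
    rw [map_mul] at hg
    rcases h.sat_of_mul_eq_zero (hrel i) hx hg with ⟨-, -, hs⟩ | hs | hs
    exacts [⟨_, by simp, hs⟩, ⟨_, by simp, hs⟩, ⟨_, by simp, hs⟩]

/-- The degeneration of a partial diagonal into two simpler ones. -/
theorem cls_addCol : (c.addCol m).cls k = c.zeroRow.cls k + (c.zeroGroup m).cls k := by
  have hX := fun p : Fin n × Fin (a + 1) =>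
    MvPolynomial.isWeightedHomogeneous_X k (multidegree n a) p
  have hform : ∀ l l', IsForm (X (c.row, l) * X (i, l') : CoxRing k n a)
      (multidegree n a (c.row, j) + multidegree n a (i, m)) := fun l l' =>
    (hX (c.row, l)).mul (hX (i, l'))
  have hrat := chowClass_divisor_eq (c.subvariety k h.valid) _ ((hform j m).sub (hform m j))
    (hform j m) h.minor_notMem_self fun hmem => ((inferInstance : (c.ideal k).IsPrime).mem_or_mem
      hmem).elim (X_notMem_ideal (h.valid.notMem_zero_row j h.mem_cols))
        (X_notMem_ideal h.notMem_zero)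
  by_cases hc : c.cols = {j}
  · rwa [h.divisor_minor_of_eq hc, h.divisor_mul_of_eq hc, map_add] at hrat
  · obtain ⟨j', hj', hne⟩ : ∃ j' ∈ c.cols, j' ≠ j := by
      by_contra! hall
      exact hc (Finset.eq_singleton_iff_unique_mem.2 ⟨h.mem_cols, hall⟩)
    rw [h.divisor_minor hj' hne, h.divisor_mul hj' hne, map_add, map_add, map_add] at hrat
    exact add_right_cancel hrat

end Addable

end Config

/-! ### Classes of linear subspaces and of diagonals -/

namespace Config

universe u

variable {k : Type u} [Field k] {n a : ℕ}

open MvPolynomial (X)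

theorem ideal_le_ideal {c c' : Config n a} (hc : c.Valid)
    (h : ∀ {B : Type u} [CommRing B] (x : Fin n × Fin (a + 1) → B), c.Sat x → c'.Sat x) :
    c'.ideal k ≤ c.ideal k := by
  have hs := hc.sat_of_ideal_le (algebraMap (CoxRing k n a) (c.ideal k).ResidueField)
    (by rw [Ideal.ker_algebraMap_residueField])
  exact (h _ hs).ideal_le_of_prime fun i => (hc.exists_notMem i).imp fun _ => X_notMem_ideal

theorem cls_congr {c c' : Config n a} (hc : c.Valid) (hc' : c'.Valid)
    (h : ∀ {B : Type u} [CommRing B] (x : Fin n × Fin (a + 1) → B), c.Sat x ↔ c'.Sat x) :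
    c.cls k = c'.cls k := by
  rw [cls, cls, le_antisymm (ideal_le_ideal (k := k) hc' fun x => (h x).2)
    (ideal_le_ideal hc fun x => (h x).1)]

/-! ### Products of coordinate subspaces -/

/-- The product of the coordinate subspaces `x_{i,j} = 0` for `j ∈ Z i`. -/
def linear (r : Fin n) (Z : Fin n → Finset (Fin (a + 1))) : Config n a := ⟨Z, ∅, r, ∅⟩

theorem valid_linear (r : Fin n) {Z : Fin n → Finset (Fin (a + 1))} (hZ : ∀ i, ∃ j, j ∉ Z i) :
    (linear r Z).Valid where
  zero_eq i hi := by simp [linear] at hi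
  row_notMem := .inr rfl
  notMem_zero_row j hj := by simp [linear] at hj
  notMem_zero j hj := by simp [linear] at hj
  exists_notMem := hZ

theorem sat_linear {B : Type*} [CommRing B] {r : Fin n} {Z : Fin n → Finset (Fin (a + 1))}
    {x : Fin n × Fin (a + 1) → B} : (linear r Z).Sat x ↔ ∀ i, ∀ j ∈ Z i, x (i, j) = 0 :=
  ⟨fun h => h.zero, fun h => ⟨h, fun i hi => by simp [linear] at hi,
    fun i hi => by simp [linear] at hi⟩⟩

theorem ideal_linear_empty (r : Fin n) :
    (linear r fun _ => (∅ : Finset (Fin (a + 1)))).ideal k = ⊥ :=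
  le_bot_iff.1 ((sat_linear.2 (by simp)).ideal_le_of_prime fun i =>
    ⟨0, by rw [Ideal.mem_bot]; exact MvPolynomial.X_ne_zero _⟩)

theorem divisor_linear {r : Fin n} {Z : Fin n → Finset (Fin (a + 1))}
    (hZ : ∀ i, ∃ j, j ∉ Z i) {i : Fin n} {j : Fin (a + 1)} (hj : ∃ j', j' ≠ j ∧ j' ∉ Z i) :
    divisor ((linear r Z).subvariety k (valid_linear r hZ)) (X (i, j)) =
      fundamentalCycle ((linear r (Function.update Z i (insert j (Z i)))).ideal k) := by
  have key : ∀ {B : Type u} [CommRing B] (x : Fin n × Fin (a + 1) → B),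
      (linear r (Function.update Z i (insert j (Z i)))).Sat x ↔
        (linear r Z).Sat x ∧ x (i, j) = 0 := by
    intro B _ x
    simp only [sat_linear]
    constructor
    · refine fun h => ⟨fun i' j' hj' => h i' j' ?_, h i j (by simp)⟩
      by_cases hi : i' = i
      · subst hi; simp [hj']
      · simpa [hi] using hj'
    · rintro ⟨h, h0⟩ i' j' hj'
      by_cases hi : i' = i
      · subst hi
        rw [Function.update_self, Finset.mem_insert] at hj'
        rcases hj' with rfl | hj'
        exacts [h0, h _ _ hj']
      · rw [Function.update_of_ne hi] at hj'
        exact h _ _ hj'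
  rw [divisor_subvariety (valid_linear r hZ) [linear r (Function.update Z i (insert j (Z i)))]]
  · simp
  · simp only [List.mem_singleton, forall_eq]
    refine ⟨valid_linear r fun i' => ?_, fun π h => (key _).1 h, fun π _ h h0 => (key _).2 ⟨h, h0⟩⟩
    by_cases hi : i' = i
    · subst hi
      simpa [and_comm] using hj
    · simpa [hi] using hZ i'
  · simp
  · exact fun π _ h h0 => ⟨_, by simp, (key _).2 ⟨h, h0⟩⟩

/-- Exchanging one coordinate hyperplane for another does not change the class. -/
theorem cls_linear_insert {r : Fin n} {Z : Fin n → Finset (Fin (a + 1))}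
    (hZ : ∀ i, ∃ j, j ∉ Z i) {i : Fin n} {j j' : Fin (a + 1)} (hj : j ∉ Z i) (hj' : j' ∉ Z i)
    (hne : j ≠ j') :
    (linear r (Function.update Z i (insert j (Z i)))).cls k =
      (linear r (Function.update Z i (insert j' (Z i)))).cls k := by
  rw [cls, cls, ← divisor_linear hZ ⟨j', hne.symm, hj'⟩, ← divisor_linear hZ ⟨j, hne, hj⟩]
  exact chowClass_divisor_eq _ _ (isForm_X i j) (isForm_X i j') (X_notMem_ideal hj)
    (X_notMem_ideal hj')

/-- The first `γ i` coordinates of each factor. -/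
def initial (a : ℕ) (γ : Fin n → ℕ) (i : Fin n) : Finset (Fin (a + 1)) :=
  Finset.univ.filter fun j => j.val < γ i

theorem mem_initial {γ : Fin n → ℕ} {i : Fin n} {j : Fin (a + 1)} :
    j ∈ initial a γ i ↔ j.val < γ i := by simp [initial]

theorem exists_notMem_initial {γ : Fin n → ℕ} (hγ : ∀ i, γ i ≤ a) (i : Fin n) :
    ∃ j, j ∉ initial a γ i :=
  ⟨Fin.last a, by simpa [mem_initial] using hγ i⟩

theorem zeta_single (i : Fin n) (V : Subvariety k n a) :
    zeta k n a i (Finsupp.single V 1) = divisor V (X (i, V.coord i)) :=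
  (Finsupp.liftAddHom_apply_single _ _ _).trans (one_zsmul _)

/-- The cycle-level operator `zeta` cuts by the first coordinate that is not identically zero, which
here is the one with index `γ i`; an initial segment therefore grows by one. -/
theorem zeta_initial {r i : Fin n} {γ : Fin n → ℕ} (hγ : ∀ i, γ i ≤ a) (hi : γ i + 1 ≤ a) :
    zeta k n a i (fundamentalCycle ((linear r (initial a γ)).ideal k)) =
      fundamentalCycle ((linear r (initial a (Function.update γ i (γ i + 1)))).ideal k) := by
  have hv := valid_linear r (exists_notMem_initial hγ)
  set V := (linear r (initial a γ)).subvariety k hv with hV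
  have h1 : fundamentalCycle ((linear r (initial a γ)).ideal k) = Finsupp.single V 1 :=
    fundamentalCycle_ideal V
  have hcoord : (V.coord i).val = γ i := by
    have hmem : (X (i, V.coord i) : CoxRing k n a) ∉ V.ideal :=
      WellFounded.min_mem wellFounded_lt
        {j : Fin (a + 1) | (X (i, j) : CoxRing k n a) ∉ V.ideal} (V.relevant i)
    have hge : γ i ≤ (V.coord i).val := by
      by_contra hlt
      exact hmem (X_mem_ideal (c := linear r (initial a γ)) (mem_initial.2 (not_le.1 hlt)))
    have hle : ¬ (⟨γ i, by omega⟩ : Fin (a + 1)) < V.coord i :=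
      WellFounded.not_lt_min wellFounded_lt
        {j : Fin (a + 1) | (X (i, j) : CoxRing k n a) ∉ V.ideal}
        (X_notMem_ideal (c := linear r (initial a γ)) (by simp [linear, mem_initial]))
    rw [Fin.lt_def] at hle
    exact le_antisymm (not_lt.1 hle) hge
  rw [h1, zeta_single, hV, divisor_linear (exists_notMem_initial hγ)]
  · congr 3
    ext i' j'
    by_cases he : i' = i
    · subst he
      rw [Function.update_self, Finset.mem_insert, mem_initial, mem_initial, Function.update_self,
        Fin.ext_iff, ← hV, hcoord]
      omega
    · rw [Function.update_of_ne he, mem_initial, mem_initial, Function.update_of_ne he]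
  · refine ⟨Fin.last a, fun he => ?_, by simpa [mem_initial] using hγ i⟩
    have := congrArg Fin.val he
    rw [← hV, hcoord, Fin.val_last] at this
    omega

theorem zeta_pow_initial {r i : Fin n} {γ : Fin n → ℕ} (hγ : ∀ i, γ i ≤ a) (m : ℕ)
    (hi : γ i + m ≤ a) :
    (zeta k n a i ^ m) (fundamentalCycle ((linear r (initial a γ)).ideal k)) =
      fundamentalCycle ((linear r (initial a (Function.update γ i (γ i + m)))).ideal k) := by
  induction m with
  | zero => simp
  | succ m ih =>
    rw [pow_succ', AddMonoid.End.coe_mul, Function.comp_apply, ih (by omega), zeta_initial]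
    · rw [Function.update_self, Function.update_idem, add_assoc]
    · intro i'
      by_cases he : i' = i
      · subst he; simp; omega
      · simpa [he] using hγ i'
    · rw [Function.update_self]; omega

theorem zetaMonomial_eq (r : Fin n) {α : Fin n → ℕ} (hα : ∀ i, α i ≤ a) :
    zetaMonomial k n a α = fundamentalCycle ((linear r (initial a α)).ideal k) := by
  -- The product is built factor by factor. Since `l` has no repetitions, the exponent at a new
  -- factor is still `0`.
  have key : ∀ l : List (Fin n), l.Nodup →
      (l.map fun i => zeta k n a i ^ α i).prod (fundamentalCycle ⊥) =
        fundamentalCycle ((linear r (initial a fun i => if i ∈ l then α i else 0)).ideal k) := by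
    intro l hl
    induction l with
    | nil =>
      have hinit : (initial a fun _ : Fin n => 0) = fun _ => ∅ := by
        ext; simp [mem_initial]
      rw [← ideal_linear_empty r]
      simp [hinit]
    | cons i l ih =>
      obtain ⟨hi, hl⟩ := List.nodup_cons.1 hl
      rw [List.map_cons, List.prod_cons, AddMonoid.End.coe_mul, Function.comp_apply,
        ih hl, zeta_pow_initial]
      · congr 4
        ext i'
        by_cases he : i' = i
        · subst he; simp [hi]
        · simp [he]
      · intro i'
        split_ifs
        exacts [hα i', Nat.zero_le _]
      · simpa [hi] using hα i
  rw [zetaMonomial, List.ofFn_eq_map, key _ (List.nodup_finRange n)]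
  simp

/-- If some `Z i` is not an initial segment, an index in it can be exchanged for a smaller missing
one without changing the class. The sum of all indices drops, so the process ends at initial
segments. -/
theorem cls_linear (r : Fin n) (Z : Fin n → Finset (Fin (a + 1))) (hZ : ∀ i, ∃ j, j ∉ Z i) :
    (linear r Z).cls k = chowClass (zetaMonomial k n a fun i => (Z i).card) := by
  induction hN : ∑ i, ∑ j ∈ Z i, j.val using Nat.strong_induction_on generalizing Z with
  | _ N ih =>
    by_cases hinit : ∀ i, ∀ j ∈ Z i, ∀ j' < j, j' ∈ Z i
    · have hcard : ∀ i, (Z i).card ≤ a := by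
        intro i
        obtain ⟨j, hj⟩ := hZ i
        have := Finset.card_lt_univ_of_notMem hj
        rw [Fintype.card_fin] at this
        omega
      have hZi : Z = initial a fun i => (Z i).card := ?_
      · rw [zetaMonomial_eq r hcard, cls, ← hZi]
      ext i j
      rw [mem_initial]
      constructor
      · intro hj
        have hsub : Finset.Iic j ⊆ Z i := fun j' hj' => by
          rcases (Finset.mem_Iic.1 hj').lt_or_eq with h | rfl
          exacts [hinit i j hj j' h, hj]
        have := Finset.card_le_card hsub
        rw [Fin.card_Iic] at this
        omega
      · intro hlt
        by_contra hj
        have hsub : Z i ⊆ Finset.Iio j := fun j' hj' => by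
          refine Finset.mem_Iio.2 (lt_of_not_ge fun hge => hj ?_)
          rcases hge.lt_or_eq with h | rfl
          exacts [hinit i j' hj' j h, hj']
        have := Finset.card_le_card hsub
        rw [Fin.card_Iio] at this
        omega
    · push Not at hinit
      obtain ⟨i, j, hj, j', hlt, hj'⟩ := hinit
      set Z₀ := Function.update Z i ((Z i).erase j) with hZ₀
      have hZ₀i : Z₀ i = (Z i).erase j := Function.update_self ..
      have hv₀ : ∀ i', ∃ l, l ∉ Z₀ i' := by
        intro i'
        by_cases he : i' = i
        · subst he
          exact ⟨j, by simp [hZ₀i]⟩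
        · simpa [hZ₀, he] using hZ i'
      have hj₀ : j' ∉ (Z i).erase j := fun h => hj' (Finset.mem_of_mem_erase h)
      have h := cls_linear_insert (k := k) (r := r) hv₀ (i := i) (j := j) (j' := j')
        (by simp [hZ₀i]) (by rwa [hZ₀i]) hlt.ne'
      rw [hZ₀i, Finset.insert_erase hj, hZ₀, Function.update_idem, Function.update_idem,
        Function.update_eq_self] at h
      have hsum : ∑ i', ∑ l ∈ Function.update Z i (insert j' ((Z i).erase j)) i', l.val < N := by
        rw [← hN]
        refine Finset.sum_lt_sum (fun i' _ => ?_) ⟨i, Finset.mem_univ i, ?_⟩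
        · by_cases he : i' = i
          · subst he
            rw [Function.update_self, Finset.sum_insert hj₀, ← Finset.add_sum_erase _ _ hj]
            exact Nat.add_le_add_right (Fin.lt_def.1 hlt).le _
          · rw [Function.update_of_ne he]
        · rw [Function.update_self, Finset.sum_insert hj₀, ← Finset.add_sum_erase _ _ hj]
          exact Nat.add_lt_add_right (Fin.lt_def.1 hlt) _
      rw [h, ih _ hsum _ _ rfl]
      · congr 2
        ext i'
        by_cases he : i' = i
        · subst he
          rw [Function.update_self, Finset.card_insert_of_notMem hj₀, Finset.card_erase_add_one hj]
        · rw [Function.update_of_ne he]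
      · intro i'
        by_cases he : i' = i
        · subst he
          exact ⟨j, by simp [hlt.ne']⟩
        · simpa [he] using hZ i'

/-! ### The class of a diagonal -/

/-- The sum of the monomials `∏ᵢ ζᵢ ^ βᵢ` with `βᵢ = z i` for `i ∉ G` and with
`∑_{i ∈ G} βᵢ = a (|G| - 1) + τ`. -/
noncomputable def diagSum (k : Type*) [Field k] (a : ℕ) (G : Finset (Fin n)) (z : Fin n → ℕ)
    (τ : ℕ) : Chow k n a :=
  ∑ β ∈ (Fintype.piFinset fun _ : Fin n => Finset.range (a + 1)) with
    (∀ i ∉ G, β i = z i) ∧ ∑ i ∈ G, β i + a = a * G.card + τ, chowClass (zetaMonomial k n a β)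

theorem diagSum_congr {G : Finset (Fin n)} {z z' : Fin n → ℕ} (h : ∀ i ∉ G, z i = z' i) (τ : ℕ) :
    diagSum k a G z τ = diagSum k a G z' τ := by
  unfold diagSum
  refine Finset.sum_congr (Finset.filter_congr fun β _ => and_congr_left fun _ =>
    forall₂_congr fun i hi => ?_) fun _ _ => rfl
  rw [h i hi]

theorem diagSum_singleton (i : Fin n) {z : Fin n → ℕ} (hz : ∀ i, z i ≤ a) :
    diagSum k a {i} z (z i) = chowClass (zetaMonomial k n a z) := by
  rw [diagSum, Finset.sum_eq_single_of_mem z]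
  · simp only [Finset.mem_filter, Fintype.mem_piFinset, Finset.mem_range, Finset.sum_singleton,
      Finset.card_singleton]
    exact ⟨fun i' => Nat.lt_succ_of_le (hz i'), fun _ _ => trivial, by omega⟩
  · intro β hβ hne
    simp only [Finset.mem_filter, Finset.sum_singleton, Finset.card_singleton,
      Finset.mem_singleton] at hβ
    refine absurd (funext fun i' => ?_) hne
    by_cases he : i' = i
    · subst he; omega
    · exact hβ.2.1 i' he

/-- A vector `β` on the right occurs on the left exactly for `l = β r - τ`. This is a legitimate
index: `∑_{i ∈ G} βᵢ ≤ a |G|` forces `β r ≥ τ`, and `β r ≤ a` bounds it above. -/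
theorem sum_diagSum {G : Finset (Fin n)} {r : Fin n} (hr : r ∉ G) (z : Fin n → ℕ) {τ : ℕ}
    (hτ : τ ≤ a) :
    ∑ l ∈ Finset.range (a + 1 - τ), diagSum k a G (Function.update z r (τ + l)) (a - l) =
      diagSum k a (insert r G) z τ := by
  simp only [diagSum, Finset.sum_filter]
  rw [Finset.sum_comm]
  refine Finset.sum_congr rfl fun β hβ => ?_
  have hβ' : ∀ i, β i ≤ a := fun i => by
    have := Fintype.mem_piFinset.1 hβ i
    rw [Finset.mem_range] at this
    omega
  have hsum : ∑ i ∈ G, β i ≤ a * G.card := by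
    have := Finset.sum_le_card_nsmul G β a fun i _ => hβ' i
    rwa [smul_eq_mul, mul_comm] at this
  have hoff : ∀ l, (∀ i ∉ G, β i = Function.update z r (τ + l) i) ↔
      β r = τ + l ∧ ∀ i ∉ insert r G, β i = z i := by
    intro l
    constructor
    · refine fun h => ⟨by simpa using h r hr, fun i hi => ?_⟩
      rw [Finset.mem_insert, not_or] at hi
      simpa [hi.1] using h i hi.2
    · rintro ⟨h1, h2⟩ i hi
      by_cases he : i = r
      · subst he; simpa using h1
      · simpa [he] using h2 i (by simp [he, hi])
  have hr' := hβ' r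
  rw [Finset.sum_insert hr, Finset.card_insert_of_notMem hr, Nat.mul_succ]
  trans ∑ l ∈ Finset.range (a + 1 - τ), if l = β r - τ then
      (if (∀ i ∉ insert r G, β i = z i) ∧ β r + ∑ i ∈ G, β i + a = a * G.card + a + τ then
        chowClass (zetaMonomial k n a β) else 0) else 0
  · refine Finset.sum_congr rfl fun l hl => ?_
    rw [Finset.mem_range] at hl
    rw [← ite_and]
    refine if_congr ?_ rfl rfl
    rw [hoff]
    constructor
    · rintro ⟨⟨h1, h2⟩, h3⟩
      exact ⟨by omega, h2, by omega⟩
    · rintro ⟨h1, h2, h3⟩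
      exact ⟨⟨by omega, h2⟩, by omega⟩
  · rw [Finset.sum_ite_eq', if_pos]
    rw [Finset.mem_range]
    omega

/-- This is the passage from the group `G` to one more point. In the `l`-th summand the extra point
has `l` additional zero coordinates and no longer interacts with the group, whose common zero set
has acquired `M.card - 1 - l` elements. -/
theorem cls_cols {G : Finset (Fin n)}
    (ih : ∀ (Z : Fin n → Finset (Fin (a + 1))) (T : Finset (Fin (a + 1))) (r : Fin n),
      (⟨Z, G, r, ∅⟩ : Config n a).Valid → (∀ i ∈ G, Z i = T) →
        (⟨Z, G, r, ∅⟩ : Config n a).cls k = diagSum k a G (fun i => (Z i).card) T.card)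
    (hG : G.Nonempty) {r : Fin n} (hr : r ∉ G) {M : Finset (Fin (a + 1))} (hM : M.Nonempty)
    (Z : Fin n → Finset (Fin (a + 1))) (T : Finset (Fin (a + 1)))
    (hv : (⟨Z, G, r, M⟩ : Config n a).Valid) (hT : ∀ i ∈ G, Z i = T) :
    (⟨Z, G, r, M⟩ : Config n a).cls k = ∑ l ∈ Finset.range M.card,
      diagSum k a G (Function.update (fun i => (Z i).card) r ((Z r).card + l))
        (T.card + M.card - 1 - l) := by
  have hvalid : ∀ M' ⊆ M, (⟨Z, G, r, M'⟩ : Config n a).Valid := fun M' hM' =>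
    ⟨hv.zero_eq, .inl hr, fun j hj => hv.notMem_zero_row j (hM' hj),
      fun j hj => hv.notMem_zero j (hM' hj), hv.exists_notMem⟩
  induction hM using Finset.Nonempty.cons_induction generalizing Z T with
  | singleton j =>
    -- Proportionality in a single column is no condition.
    rw [cls_congr (k := k) hv (hvalid ∅ (by simp)), ih Z T r (hvalid ∅ (by simp)) hT]
    · simp only [Finset.card_singleton, Finset.sum_range_one, add_zero, Nat.add_sub_cancel,
        Nat.sub_zero]
      rw [Function.update_eq_self r fun i => (Z i).card]
    · refine fun x => ⟨fun h => ⟨h.zero, h.group, fun i _ l hl => by simp at hl⟩,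
        fun h => ⟨h.zero, h.group, fun i _ l hl l' hl' => ?_⟩⟩
      rw [Finset.mem_singleton.1 hl, Finset.mem_singleton.1 hl']
  | cons m M hm hM ihM =>
    obtain ⟨j, hj⟩ := hM
    obtain ⟨i, hi⟩ := hG
    have hadd : (⟨Z, G, r, M⟩ : Config n a).Addable i j m :=
      ⟨hvalid M (Finset.subset_cons hm), hr, hi, hj, hm,
        hv.notMem_zero_row m (Finset.mem_cons_self (h := hm) m M),
        hv.notMem_zero m (Finset.mem_cons_self (h := hm) m M) i hi⟩
    have hmT : m ∉ T := hT i hi ▸ hadd.notMem_zero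
    have hcls : (⟨Z, G, r, Finset.cons m M hm⟩ : Config n a).cls k = _ :=
      (congrArg (fun S => (⟨Z, G, r, S⟩ : Config n a).cls k) (Finset.cons_eq_insert m M hm)).trans
        hadd.cls_addCol
    have hrow := ih (Function.update Z r (Z r ∪ M)) T r hadd.valid_zeroRow fun i' hi' => by
      have he : i' ≠ r := fun he => hr (he ▸ hi')
      rw [Function.update_of_ne he, hT i' hi']
    have hgroup := ihM (fun i => if i ∈ G then insert m (Z i) else Z i) (insert m T)
      hadd.valid_zeroGroup (fun i' hi' => by simp [hi', hT i' hi']) fun M' hM' =>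
        ⟨hadd.valid_zeroGroup.zero_eq, .inl hr,
          fun l hl => hadd.valid_zeroGroup.notMem_zero_row l (hM' hl),
          fun l hl => hadd.valid_zeroGroup.notMem_zero l (hM' hl),
          hadd.valid_zeroGroup.exists_notMem⟩
    have hdisj : Disjoint (Z r) M := Finset.disjoint_right.2 fun l hl =>
      hv.notMem_zero_row l (Finset.mem_cons_of_mem (hb := hm) hl)
    refine hcls.trans ((congrArg₂ (· + ·) hrow hgroup).trans ?_)
    -- The last summand, `l = M.card`, is the class of `zeroRow`. The others come from the induction
    -- hypothesis for `zeroGroup m`, where `T` has gained `m`.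
    rw [Finset.card_cons, Finset.sum_range_succ, add_comm]
    congr 1
    · refine Finset.sum_congr rfl fun l _ => ?_
      rw [Finset.card_insert_of_notMem hmT]
      have : T.card + 1 + M.card - 1 - l = T.card + (M.card + 1) - 1 - l := by omega
      rw [this]
      refine diagSum_congr (fun i' hi' => ?_) _
      by_cases he : i' = r
      · subst he; simp [hr]
      · simp [he, hi']
    · have : T.card + (M.card + 1) - 1 - M.card = T.card := by omega
      rw [this]
      refine diagSum_congr (fun i' hi' => ?_) _
      by_cases he : i' = r
      · subst he; simp [Finset.card_union_of_disjoint hdisj]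
      · simp [he]

/-- Induction on the group: a point `s` of the group becomes the row, and `cls_cols` and
`sum_diagSum` then perform the step. For a single point the variety is a product of coordinate
subspaces. -/
theorem cls_diag {G : Finset (Fin n)} (hG : G.Nonempty) (Z : Fin n → Finset (Fin (a + 1)))
    (T : Finset (Fin (a + 1))) (r : Fin n) (hv : (⟨Z, G, r, ∅⟩ : Config n a).Valid)
    (hT : ∀ i ∈ G, Z i = T) :
    (⟨Z, G, r, ∅⟩ : Config n a).cls k = diagSum k a G (fun i => (Z i).card) T.card := by
  have hcard : ∀ {S : Finset (Fin (a + 1))}, (∃ j, j ∉ S) → S.card ≤ a := by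
    rintro S ⟨j, hj⟩
    have := Finset.card_lt_univ_of_notMem hj
    rw [Fintype.card_fin] at this
    omega
  induction hG using Finset.Nonempty.cons_induction generalizing Z T r with
  | singleton i =>
    have hTi : Z i = T := hT i (by simp)
    rw [← hTi, diagSum_singleton i (z := fun i => (Z i).card) fun i' => hcard (hv.exists_notMem i'),
      ← cls_linear r Z hv.exists_notMem]
    refine cls_congr hv (valid_linear r hv.exists_notMem) fun x => ?_
    rw [sat_linear]
    refine ⟨fun h => h.zero, fun h => ⟨h, fun i₁ h₁ i₂ h₂ j j' => ?_,
      fun i _ l hl => by simp at hl⟩⟩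
    rw [Finset.mem_singleton.1 h₁, Finset.mem_singleton.1 h₂, mul_comm]
  | cons s G hs hG ih =>
    have hZs : Z s = T := hT s (Finset.mem_cons_self (h := hs) s G)
    have hZG : ∀ i ∈ G, Z i = T := fun i hi => hT i (Finset.mem_cons_of_mem (hb := hs) hi)
    -- The coordinates in `T` vanish on all points concerned, so coincidence with `s` amounts to
    -- proportionality in the columns of `Tᶜ`.
    have hv' : (⟨Z, G, s, Tᶜ⟩ : Config n a).Valid :=
      ⟨fun i hi i' hi' => (hZG i hi).trans (hZG i' hi').symm, .inl hs,
        fun j hj => by simpa [hZs] using hj, fun j hj i hi => by simpa [hZG i hi] using hj,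
        hv.exists_notMem⟩
    have hTc : Tᶜ.Nonempty := by
      obtain ⟨j, hj⟩ := hv.exists_notMem s
      exact ⟨j, by simpa [← hZs] using hj⟩
    rw [cls_congr (k := k) hv hv', cls_cols ih hG hs hTc Z T hv' hZG, hZs, Finset.cons_eq_insert,
      ← sum_diagSum hs _ (hcard (hZs ▸ hv.exists_notMem s)), Finset.card_compl, Fintype.card_fin]
    · have hle : T.card ≤ a := hcard (hZs ▸ hv.exists_notMem s)
      refine Finset.sum_congr rfl fun l _ => ?_
      congr 1
      omega
    · have hmem : ∀ {i}, i ∈ G → i ∈ Finset.cons s G hs := fun hi => Finset.mem_cons_of_mem hi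
      intro B _ x
      refine ⟨fun h => ⟨h.zero,
        fun i hi i' hi' => h.group i (hmem hi) i' (hmem hi'),
        fun i hi l _ l' _ => h.group s (Finset.mem_cons_self s G (h := hs)) i (hmem hi) l l'⟩,
        fun h => ⟨h.zero, ?_, fun i _ l hl => by simp at hl⟩⟩
      have key : ∀ i ∈ G, ∀ l l', x (s, l) * x (i, l') = x (s, l') * x (i, l) := by
        intro i hi l l'
        by_cases hl : l ∈ T
        · rw [h.zero s l (by simpa [hZs] using hl), h.zero i l (by simpa [hZG i hi] using hl),
            zero_mul, mul_zero]
        by_cases hl' : l' ∈ T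
        · rw [h.zero s l' (by simpa [hZs] using hl'), h.zero i l' (by simpa [hZG i hi] using hl'),
            zero_mul, mul_zero]
        exact h.row i hi l (Finset.mem_compl.2 hl) l' (Finset.mem_compl.2 hl')
      intro i hi i' hi' l l'
      rcases (Finset.mem_cons (h := hs)).1 hi with rfl | h₁ <;>
        rcases (Finset.mem_cons (h := hs)).1 hi' with rfl | h₂
      · exact mul_comm _ _
      · exact key i' h₂ l l'
      · rw [mul_comm, ← key i h₁ l l', mul_comm]
      · exact h.group i h₁ i' h₂ l l'

/-- The ideal of the small diagonal is that of the configuration in which all points coincide. -/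
theorem diagonalIdeal_eq (r : Fin n) :
    diagonalIdeal k n a = (⟨fun _ => ∅, Finset.univ, r, ∅⟩ : Config n a).ideal k := by
  -- With no zeros, no columns and a full group, only the scalings and the common vector occur in
  -- the generic point, so the two parametrizations differ by an injective renaming.
  let φ : Fin n ⊕ Fin (a + 1) → Param n a := Sum.elim .scale .col
  have hφ : Function.Injective φ := by
    rintro (i | j) (i' | j') h <;> simp_all [φ]
  have h : ∀ f : CoxRing k n a,
      MvPolynomial.aeval ((⟨fun _ => ∅, Finset.univ, r, ∅⟩ : Config n a).generic k) f =
        MvPolynomial.rename φ (MvPolynomial.aeval (R := k) (fun p : Fin n × Fin (a + 1) =>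
          (X (Sum.inl p.1) * X (Sum.inr p.2) : MvPolynomial (Fin n ⊕ Fin (a + 1)) k)) f) := by
    intro f
    rw [← AlgHom.comp_apply]
    congr 1
    ext1 p
    simp [generic, entry, φ]
  ext f
  rw [diagonalIdeal, ideal, RingHom.mem_ker, RingHom.mem_ker, h,
    map_eq_zero_iff _ (MvPolynomial.rename_injective φ hφ)]

end Config

end MultiProj

theorem proposition6p1 (k : Type*) [Field k] (n a : ℕ) (hn : 1 ≤ n) :
    MultiProj.chowClass (MultiProj.fundamentalCycle (MultiProj.diagonalIdeal k n a)) =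
      ∑ α ∈ (Fintype.piFinset fun _ : Fin n => Finset.range (a + 1)) with
          ∑ i, α i = a * (n - 1),
        MultiProj.chowClass (MultiProj.zetaMonomial k n a α) := by
  have r : Fin n := ⟨0, hn⟩
  have hv : (⟨fun _ => ∅, Finset.univ, r, ∅⟩ : MultiProj.Config n a).Valid :=
    ⟨fun _ _ _ _ => rfl, .inr rfl, by simp, by simp, fun _ => ⟨0, by simp⟩⟩
  rw [MultiProj.Config.diagonalIdeal_eq r]
  refine (MultiProj.Config.cls_diag ⟨r, Finset.mem_univ r⟩ _ ∅ r hv fun _ _ => rfl).trans ?_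
  rw [MultiProj.Config.diagSum]
  congr 1
  refine Finset.filter_congr fun β _ => ?_
  -- Here the group is everything and `τ = 0`. Writing `n` as a successor removes the truncated
  -- subtraction, and `a` cancels from both sides of the degree condition.
  obtain ⟨n, rfl⟩ : ∃ m, n = m + 1 := ⟨n - 1, by omega⟩
  simp [Nat.mul_succ]
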